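/- Let $(M,h)$ be a smooth oriented Riemannian $3$-manifold with Levi-Civita connection $\nabla$, and write $(X,Y,Z,W):=h(R(X,Y)Z,W)$ for its curvature tensor, with the sign convention $R(X,Y)Z=\nabla_Y\nabla_XZ-\nabla_X\nabla_YZ+\nabla_{[X,Y]}Z$, so that the plane spanned by orthonormal $X,Y$ has sectional curvature $(X,Y,X,Y)$. Let $L,\varepsilon>0$, put $S^1=\mathbb{R}/L\mathbb{Z}$, and let $\alpha_t:S^1\to M$, $t\in(-\varepsilon,\varepsilon)$, be closed curves depending smoothly on $(t,s)$ (for example, a smooth family of embeddings), each parametrized by arclength $s$, with nowhere vanishing curvature $\kappa=\|\frac{D}{\partial s}T\|$, where $T=\partial_s\alpha_t$. Let $N=\frac1\kappa\frac{D}{\partial s}T$, $B=T\times N$ and $\tau=h(\frac{D}{\partial s}N,B)$ be the principal normal, the binormal and the torsion. Functions on $S^1$ are regarded as functions of $s\in\mathbb{R}$. Assume that $\alpha_t$ solves the vortex filament equation $\partial_t\alpha_t=\kappa B$. 1. The functions $\kappa$ and $\tau$ are smooth in $(t,s)$ and, for all $t\in(-\varepsilon,\varepsilon)$ and $s\in\mathbb{R}$,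 $$\frac{\partial\kappa}{\partial t}=-2\tau\frac{\partial\kappa}{\partial s}-\kappa\frac{\partial\tau}{\partial s}+\kappa\,(T,B,T,N),$$ $$\frac{\partial\tau}{\partial t}=\frac{\partial}{\partial s}\Big(\frac1\kappa\frac{\partial^2\kappa}{\partial s^2}-\tau^2+\frac12\kappa^2+(T,B,T,B)\Big)-\kappa\,(B,T,N,B).$$ 2. Suppose in addition that all sectional curvatures of $M$ are equal to a constant $K_0$. Then $(T,B,T,B)=K_0$ and $(B,T,N,B)=(T,B,T,N)=0$. Put, for $s\in\mathbb{R}$, $$\psi_t(s)=\kappa(t,s)\,e^{i\int_0^s\tau(t,x)\,dx},\qquad A(t)=\Big(\frac1\kappa\frac{\partial^2\kappa}{\partial s^2}-\tau^2+\frac12\kappa^2\Big)(t,s)\Big|_{s=0}.$$ Then $A$ is continuous, and for all $t\in(-\varepsilon,\varepsilon)$, $s\in\mathbb{R}$, $$-i\frac{\partial\psi}{\partial t}=\frac{\partial^2\psi}{\partial s^2}+\frac12|\psi|^2\psi-\psi\cdot A(t),$$ and $\Psi_t(s)=e^{i\int_0^tA(x)\,dx}\,\psi_t(s)$ satisfies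 the nonlinear Schrödinger equation $$-i\frac{\partial\Psi}{\partial t}=\frac{\partial^2\Psi}{\partial s^2}+\frac12|\Psi|^2\Psi;$$ here $\psi$ and $\Psi$ are smooth in $s$ and differentiable in $t$. -/

import Mathlib

open Set Topology Bundle Manifold
open scoped ContDiff

noncomputable section

namespace Filament

/-- The model space `ℝ³`. -/
abbrev E3 : Type := EuclideanSpace ℝ (Fin 3)

/-! ### Cross product of an oriented Euclidean three-space -/

section Cross

variable {V : Type*} [NormedAddCommGroup V] [InnerProductSpace ℝ V]
  [Fact (Module.finrank ℝ V = 3)]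

/-- The cross product of an oriented three-dimensional inner product space: `u × v` is the vector
whose inner product with every `w` is the oriented volume of `(u, v, w)`, see `inner_cross`. -/
def cross (o : Orientation ℝ V (Fin 3)) (u v : V) : V :=
  haveI : FiniteDimensional ℝ V := FiniteDimensional.of_fact_finrank_eq_succ 2
  ∑ i, o.volumeForm ![u, v, stdOrthonormalBasis ℝ V i] • stdOrthonormalBasis ℝ V i

theorem inner_cross (o : Orientation ℝ V (Fin 3)) (u v w : V) :
    inner ℝ (cross o u v) w = o.volumeForm ![u, v, w] := by
  have : FiniteDimensional ℝ V := FiniteDimensional.of_fact_finrank_eq_succ 2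
  have hlin : ∀ x : V, o.volumeForm ![u, v, x] =
      o.volumeForm.toMultilinearMap.toLinearMap ![u, v, 0] 2 x := by
    intro x
    have hx : Function.update ![u, v, (0 : V)] 2 x = ![u, v, x] := by
      ext i; fin_cases i <;> simp [Function.update]
    simp [MultilinearMap.toLinearMap, hx]
  have hw := (stdOrthonormalBasis ℝ V).sum_repr' w
  conv_rhs => rw [hlin, ← hw, map_sum]
  rw [cross, sum_inner]
  refine Finset.sum_congr rfl fun i _ => ?_
  rw [map_smul, ← hlin, inner_smul_left, smul_eq_mul, mul_comm]
  rfl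

end Cross

/-! ### Charts -/

section Manifold

variable {M : Type*} [TopologicalSpace M] [ChartedSpace E3 M]

/-- The tangent space at `x` of a manifold modelled on `ℝ³`. -/
abbrev T3 (x : M) : Type := TangentSpace 𝓘(ℝ, E3) x

instance finrank_T3 (x : M) : Fact (Module.finrank ℝ (T3 x) = 3) :=
  ⟨(finrank_euclideanSpace_fin : Module.finrank ℝ E3 = 3)⟩

/-- The chart around `x₀`, as a map to `ℝ³`. -/
abbrev chart (x₀ : M) : PartialEquiv M E3 := extChartAt 𝓘(ℝ, E3) x₀

/-- The partial derivative `∂ᵢ f` at `y` of a function on `ℝ³`. -/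
def pd (i : Fin 3) (f : E3 → ℝ) (y : E3) : ℝ := fderiv ℝ f y (EuclideanSpace.single i 1)

variable [IsManifold 𝓘(ℝ, E3) ∞ M]

/-- The value at `x` (in the domain of the chart around `x₀`) of the coordinate vector field `∂ᵢ`
of the chart around `x₀`. The trivialization of the tangent bundle is the derivative of this
chart. -/
def coordField (x₀ : M) (i : Fin 3) (x : M) : T3 x :=
  (trivializationAt E3 (TangentSpace 𝓘(ℝ, E3) : M → Type) x₀).symmL ℝ x
    (EuclideanSpace.single i 1)

/-- The `i`-th component, in the chart around `x₀`, of a tangent vector `v` at `x`. -/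
def coord (x₀ : M) (i : Fin 3) (x : M) (v : T3 x) : ℝ :=
  (trivializationAt E3 (TangentSpace 𝓘(ℝ, E3) : M → Type) x₀).continuousLinearMapAt ℝ x v i

variable [RiemannianBundle (fun x : M => TangentSpace 𝓘(ℝ, E3) x)]

/-- An orientation of `M`: orientations of the tangent spaces that depend continuously on the
point, i.e. near `x₀` the coordinate frames of the chart around `x₀` are all positive or all
negative. -/
def IsManifoldOrientation (o : ∀ x : M, Orientation ℝ (T3 x) (Fin 3)) : Prop :=
  ∀ x₀ : M, ∀ᶠ x in 𝓝 x₀,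
    SignType.sign ((o x).volumeForm fun i => coordField x₀ i x) =
      SignType.sign ((o x₀).volumeForm fun i => coordField x₀ i x₀)

/-! ### Levi-Civita connection and curvature -/

/-- The metric coefficients `g_{ij}` in the chart around `x₀`. -/
def metricCoeff (x₀ : M) (y : E3) : Matrix (Fin 3) (Fin 3) ℝ := fun i j =>
  inner ℝ (coordField x₀ i ((chart x₀).symm y)) (coordField x₀ j ((chart x₀).symm y))

/-- The Christoffel symbols `Γᵏᵢⱼ` of the Levi-Civita connection in the chart around `x₀`. -/
def christoffel (x₀ : M) (k i j : Fin 3) (y : E3) : ℝ :=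
  (1 / 2) * ∑ l, (metricCoeff x₀ y)⁻¹ k l *
    (pd i (fun z => metricCoeff x₀ z j l) y + pd j (fun z => metricCoeff x₀ z i l) y
      - pd l (fun z => metricCoeff x₀ z i j) y)

/-- The coefficient of `∂ₘ` in `R(∂ᵢ, ∂ⱼ)∂ₖ`, in the chart around `x₀`, with the sign convention
`R(X, Y)Z = ∇_Y ∇_X Z - ∇_X ∇_Y Z + ∇_[X, Y] Z`. -/
def curvatureCoeff (x₀ : M) (m i j k : Fin 3) (y : E3) : ℝ :=
  pd j (christoffel x₀ m i k) y - pd i (christoffel x₀ m j k) y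
    + ∑ l, (christoffel x₀ l i k y * christoffel x₀ m j l y
      - christoffel x₀ l j k y * christoffel x₀ m i l y)

/-- The Riemannian curvature `R(X, Y)Z` at `x`. -/
def riemann {x : M} (X Y Z : T3 x) : T3 x :=
  ∑ m, (∑ i, ∑ j, ∑ k, curvatureCoeff x m i j k (chart x x) *
    coord x i x X * coord x j x Y * coord x k x Z) • coordField x m x

/-- The curvature tensor `(X, Y, Z, W) = ⟨R(X, Y)Z, W⟩`. -/
def curv {x : M} (X Y Z W : T3 x) : ℝ := inner ℝ (riemann X Y Z) W

/-- The sectional curvature of the plane spanned by `X` and `Y`. -/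
def sectionalCurvature {x : M} (X Y : T3 x) : ℝ :=
  curv X Y X Y / (‖X‖ ^ 2 * ‖Y‖ ^ 2 - inner ℝ X Y ^ 2)

variable (M) in
/-- All sectional curvatures of `M` are equal to `K₀`. -/
def HasConstantCurvature (K₀ : ℝ) : Prop :=
  ∀ (x : M) (X Y : T3 x), LinearIndependent ℝ ![X, Y] → sectionalCurvature X Y = K₀

/-! ### Curves and their Frenet frames -/

/-- The velocity of a curve. -/
def velocity (γ : ℝ → M) (s : ℝ) : T3 (γ s) := mfderiv 𝓘(ℝ, ℝ) 𝓘(ℝ, E3) γ s (1 : ℝ)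

/-- The covariant derivative `DV/ds` of a vector field `V` along `γ`: in coordinates,
`(DV/ds)ᵏ = dVᵏ/ds + Γᵏᵢⱼ (dγⁱ/ds) Vʲ`. The coordinates used at `s` are those of the chart
around `γ s`. -/
def covDeriv (γ : ℝ → M) (V : ∀ s, T3 (γ s)) (s : ℝ) : T3 (γ s) :=
  ∑ k, (deriv (fun r => coord (γ s) k (γ r) (V r)) s
    + ∑ i, ∑ j, christoffel (γ s) k i j (chart (γ s) (γ s)) *
      coord (γ s) i (γ s) (velocity γ s) * coord (γ s) j (γ s) (V s)) • coordField (γ s) k (γ s)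

/-- The curvature `κ` of a unit speed curve. -/
def curvature (γ : ℝ → M) (s : ℝ) : ℝ := ‖covDeriv γ (velocity γ) s‖

/-- The principal normal `N` of a unit speed curve. -/
def normal (γ : ℝ → M) (s : ℝ) : T3 (γ s) := (curvature γ s)⁻¹ • covDeriv γ (velocity γ) s

/-- The binormal `B = T × N` of a unit speed curve. -/
def binormal (o : ∀ x : M, Orientation ℝ (T3 x) (Fin 3)) (γ : ℝ → M) (s : ℝ) : T3 (γ s) :=
  cross (o (γ s)) (velocity γ s) (normal γ s)

/-- The torsion `τ = ⟨DN/ds, B⟩` of a unit speed curve. -/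
def torsion (o : ∀ x : M, Orientation ℝ (T3 x) (Fin 3)) (γ : ℝ → M) (s : ℝ) : ℝ :=
  inner ℝ (covDeriv γ (normal γ) s) (binormal o γ s)

/-- A time-dependent closed curve `ℝ / Lℤ → M`, with its parameter lifted to the real line. -/
def lift {L : ℝ} (α : ℝ → AddCircle L → M) (t s : ℝ) : M := α t (s : AddCircle L)

end Manifold

/-! ### Hasimoto's transformation -/

/-- `κ''/κ - τ² + κ²/2`, for functions `κ` and `τ` of the arclength. -/
def potential (κ τ : ℝ → ℝ) (s : ℝ) : ℝ :=
  1 / κ s * deriv (deriv κ) s - τ s ^ 2 + 1 / 2 * κ s ^ 2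

/-- Hasimoto's function `ψ(s) = κ(s) exp(i ∫₀ˢ τ)`. -/
def hasimoto (κ τ : ℝ → ℝ) (s : ℝ) : ℂ :=
  κ s * Complex.exp (Complex.I * ((∫ x in (0 : ℝ)..s, τ x : ℝ) : ℂ))

/-- The gauge-rotated function `Ψ(t, s) = exp(i ∫₀ᵗ A) ψ(t, s)`. -/
def gaugeRotate (A : ℝ → ℝ) (ψ : ℝ → ℝ → ℂ) (t s : ℝ) : ℂ :=
  Complex.exp (Complex.I * ((∫ x in (0 : ℝ)..t, A x : ℝ) : ℂ)) * ψ t s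

end Filament

end

open Filament

noncomputable section

namespace Filament

/-! Write `D_s`, `D_t` for the covariant derivatives along the two-parameter map `(t, s) ↦ α_t(s)`.
Everything follows from three facts: the Frenet equations, torsion-freeness `D_s ∂_t α = D_t ∂_s α`
(`covSnd_velFst`), and the commutator `D_t D_s V - D_s D_t V = R(T, ∂_t α) V`
(`SmoothField.covFst_covSnd_sub`).

Since `∂_t α = κB`, torsion-freeness gives `D_t T = D_s (κB) = κ' B - κτ N`. Apply the commutator to
`T`, where `D_t D_s T = D_t (κN) = κ_t N + κ D_t N`. As `D_t N` is orthogonal to `N`, the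
`N`-component is the equation for `κ_t`, and the `B`-component gives `⟨D_t N, B⟩ = κ''/κ - τ² +
(T,B,T,B)`. Apply the commutator to `N` and differentiate `τ = ⟨D_s N, B⟩` in `t`: the term `⟨D_t
D_s N, B⟩` yields `∂_s ⟨D_t N, B⟩ - κ(B,T,N,B)`, and `⟨D_s N, D_t B⟩ = κκ'` accounts for the summand
`κ²/2`.

In constant curvature the symmetries of the curvature tensor and polarization of the sectional
curvature remove the mixed terms, and the constant `(T,B,T,B)` disappears under `∂_s`. Then `∂_t ∫₀ˢ
τ` is the potential at `s` minus the potential at `0`. The first gives the cubic Schrödinger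
equation for `ψ`, the second is the term `A(t)`, which a phase depending on `t` alone removes.

Most of the work is the geometry behind the three facts, since connection and curvature are given by
Christoffel symbols and the covariant derivative at each point uses the chart around that point. The
Koszul formula (`koszul`) gives metric compatibility and the transformation law
`christoffelMap_transition`. This law shows that the covariant derivative has the same expression in
every chart (`DiffAlong.hasDerivAt`), so near a given point one fixed chart suffices and the
commutator becomes a calculation with symmetric second derivatives. -/

theorem eq_sum_smul_single (w : E3) : w = ∑ k, w k • EuclideanSpace.single k (1 : ℝ) := by
  ext i; simp [Pi.single_apply]

/-! ### Bilinear maps on `ℝ³` given by their coefficients -/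

/-- The bilinear form with coefficients `a i j`. -/
def bilinForm (a : Fin 3 → Fin 3 → ℝ) : E3 →ₗ[ℝ] E3 →ₗ[ℝ] ℝ :=
  LinearMap.mk₂ ℝ (fun u v => ∑ i, ∑ j, a i j * (u i * v j))
    (fun u u' v => by
      simp only [← Finset.sum_add_distrib, PiLp.add_apply, add_mul, mul_add])
    (fun c u v => by
      simp only [PiLp.smul_apply, smul_eq_mul, Finset.mul_sum]
      exact Finset.sum_congr rfl fun i _ => Finset.sum_congr rfl fun j _ => by ring)
    (fun u v v' => by
      simp only [← Finset.sum_add_distrib, PiLp.add_apply, mul_add])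
    (fun c u v => by
      simp only [PiLp.smul_apply, smul_eq_mul, Finset.mul_sum]
      exact Finset.sum_congr rfl fun i _ => Finset.sum_congr rfl fun j _ => by ring)

theorem bilinForm_apply (a : Fin 3 → Fin 3 → ℝ) (u v : E3) :
    bilinForm a u v = ∑ i, ∑ j, a i j * (u i * v j) := rfl

/-- The vector-valued bilinear map with components `∑ c k i j uᵢ vⱼ`. -/
def bilinMap (c : Fin 3 → Fin 3 → Fin 3 → ℝ) : E3 →ₗ[ℝ] E3 →ₗ[ℝ] E3 :=
  ∑ k, (bilinForm (c k)).compr₂ (LinearMap.toSpanSingleton ℝ E3 (EuclideanSpace.single k 1))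

theorem bilinMap_eq_sum (c : Fin 3 → Fin 3 → Fin 3 → ℝ) (u v : E3) :
    bilinMap c u v = ∑ k, bilinForm (c k) u v • EuclideanSpace.single k (1 : ℝ) := by
  simp [bilinMap]

theorem bilinMap_apply (c : Fin 3 → Fin 3 → Fin 3 → ℝ) (u v : E3) (k : Fin 3) :
    bilinMap c u v k = ∑ i, ∑ j, c k i j * (u i * v j) := by
  simp [bilinMap_eq_sum, Pi.single_apply, bilinForm_apply]

theorem HasDerivAt.euclidean_apply {u : ℝ → E3} {u' : E3} {s : ℝ} (h : HasDerivAt u u' s)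
    (i : Fin 3) : HasDerivAt (fun r => u r i) (u' i) s :=
  (EuclideanSpace.proj i : E3 →L[ℝ] ℝ).hasFDerivAt.comp_hasDerivAt s h

theorem hasDerivAt_bilinForm {a : E3 → Fin 3 → Fin 3 → ℝ} {y u v : ℝ → E3} {y' u' v' : E3} {s : ℝ}
    (h : ∀ i j, DifferentiableAt ℝ (fun z => a z i j) (y s)) (hy : HasDerivAt y y' s)
    (hu : HasDerivAt u u' s) (hv : HasDerivAt v v' s) :
    HasDerivAt (fun r => bilinForm (a (y r)) (u r) (v r))
      (bilinForm (fun i j => fderiv ℝ (fun z => a z i j) (y s) y') (u s) (v s)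
        + bilinForm (a (y s)) u' (v s) + bilinForm (a (y s)) (u s) v') s := by
  simp only [bilinForm_apply, ← Finset.sum_add_distrib]
  refine HasDerivAt.fun_sum fun i _ => HasDerivAt.fun_sum fun j _ => ?_
  have h1 := ((h i j).hasFDerivAt.comp_hasDerivAt s hy).mul
    ((HasDerivAt.euclidean_apply hu i).mul (HasDerivAt.euclidean_apply hv j))
  convert! h1 using 1
  simp; ring

theorem hasDerivAt_bilinMap {c : E3 → Fin 3 → Fin 3 → Fin 3 → ℝ} {y u v : ℝ → E3} {y' u' v' : E3}
    {s : ℝ} (h : ∀ k i j, DifferentiableAt ℝ (fun z => c z k i j) (y s)) (hy : HasDerivAt y y' s)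
    (hu : HasDerivAt u u' s) (hv : HasDerivAt v v' s) :
    HasDerivAt (fun r => bilinMap (c (y r)) (u r) (v r))
      (bilinMap (fun k i j => fderiv ℝ (fun z => c z k i j) (y s) y') (u s) (v s)
        + bilinMap (c (y s)) u' (v s) + bilinMap (c (y s)) (u s) v') s := by
  simp only [bilinMap_eq_sum, ← Finset.sum_add_distrib, ← add_smul]
  exact HasDerivAt.fun_sum fun k _ =>
    (hasDerivAt_bilinForm (a := fun z => c z k) (h k) hy hu hv).smul_const _

theorem contDiffAt_bilinForm {P : Type*} [NormedAddCommGroup P] [NormedSpace ℝ P]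
    {a : P → Fin 3 → Fin 3 → ℝ} {u v : P → E3} {n : ℕ∞ω} {p : P}
    (h : ∀ i j, ContDiffAt ℝ n (fun q => a q i j) p) (hu : ContDiffAt ℝ n u p)
    (hv : ContDiffAt ℝ n v p) : ContDiffAt ℝ n (fun q => bilinForm (a q) (u q) (v q)) p := by
  have hc {w : P → E3} (hw : ContDiffAt ℝ n w p) (i : Fin 3) :
      ContDiffAt ℝ n (fun q => w q i) p :=
    (EuclideanSpace.proj i : E3 →L[ℝ] ℝ).contDiff.contDiffAt.comp p hw
  simp only [bilinForm_apply]
  exact ContDiffAt.sum fun i _ => ContDiffAt.sum fun j _ =>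
    (h i j).mul ((hc hu i).mul (hc hv j))

theorem contDiffAt_bilinMap {P : Type*} [NormedAddCommGroup P] [NormedSpace ℝ P]
    {c : P → Fin 3 → Fin 3 → Fin 3 → ℝ} {u v : P → E3} {n : ℕ∞ω} {p : P}
    (h : ∀ k i j, ContDiffAt ℝ n (fun q => c q k i j) p) (hu : ContDiffAt ℝ n u p)
    (hv : ContDiffAt ℝ n v p) : ContDiffAt ℝ n (fun q => bilinMap (c q) (u q) (v q)) p := by
  simp only [bilinMap_eq_sum]
  exact ContDiffAt.sum fun k _ => (contDiffAt_bilinForm (h k) hu hv).smul contDiffAt_const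

theorem fderiv_eq_sum_pd (f : E3 → ℝ) (y w : E3) : fderiv ℝ f y w = ∑ k, w k * pd k f y := by
  conv_lhs => rw [eq_sum_smul_single w]
  simp [map_sum, pd]

theorem contDiffAt_pd {f : E3 → ℝ} {y : E3} (h : ContDiffAt ℝ ∞ f y) (i : Fin 3) :
    ContDiffAt ℝ ∞ (pd i f) y :=
  (h.fderiv_right (m := ∞) (by simp)).clm_apply contDiffAt_const

/-! ### Coordinates of tangent vectors -/

section

variable {M : Type*} [TopologicalSpace M] [ChartedSpace E3 M]

theorem isOpen_source (x₀ : M) : IsOpen (chart x₀).source := isOpen_extChartAt_source x₀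

theorem isOpen_target (x₀ : M) : IsOpen (chart x₀).target := isOpen_extChartAt_target x₀

theorem mem_source (x₀ : M) : x₀ ∈ (chart x₀).source := mem_extChartAt_source x₀

variable [IsManifold 𝓘(ℝ, E3) ∞ M]

/-- The coordinate vector of a tangent vector, in the chart around `x₀`. -/
def coords (x₀ x : M) : T3 x →L[ℝ] E3 :=
  (trivializationAt E3 (TangentSpace 𝓘(ℝ, E3) : M → Type) x₀).continuousLinearMapAt ℝ x

/-- The tangent vector with given coordinates in the chart around `x₀`. -/
def ofCoords (x₀ x : M) : E3 →L[ℝ] T3 x :=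
  (trivializationAt E3 (TangentSpace 𝓘(ℝ, E3) : M → Type) x₀).symmL ℝ x

theorem coord_eq (x₀ : M) (i : Fin 3) (x : M) (v : T3 x) : coord x₀ i x v = coords x₀ x v i := rfl

theorem coordField_eq (x₀ : M) (i : Fin 3) (x : M) :
    coordField x₀ i x = ofCoords x₀ x (EuclideanSpace.single i 1) := rfl

theorem mem_baseSet_iff {x₀ x : M} :
    x ∈ (trivializationAt E3 (TangentSpace 𝓘(ℝ, E3) : M → Type) x₀).baseSet ↔
      x ∈ (chart x₀).source := by
  rw [extChartAt_source]; rfl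

theorem coords_ofCoords {x₀ x : M} (h : x ∈ (chart x₀).source) (w : E3) :
    coords x₀ x (ofCoords x₀ x w) = w :=
  Trivialization.continuousLinearMapAt_symmL _ (mem_baseSet_iff.2 h) w

theorem ofCoords_coords {x₀ x : M} (h : x ∈ (chart x₀).source) (v : T3 x) :
    ofCoords x₀ x (coords x₀ x v) = v :=
  Trivialization.symmL_continuousLinearMapAt _ (mem_baseSet_iff.2 h) v

theorem coords_injective {x₀ x : M} (h : x ∈ (chart x₀).source) {v w : T3 x}
    (hvw : coords x₀ x v = coords x₀ x w) : v = w := by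
  rw [← ofCoords_coords h v, hvw, ofCoords_coords h]

theorem sum_smul_coordField (x₀ x : M) (a : Fin 3 → ℝ) :
    ∑ k, a k • coordField x₀ k x = ofCoords x₀ x (WithLp.toLp 2 a) := by
  rw [eq_sum_smul_single (WithLp.toLp 2 a), map_sum]
  simp [coordField_eq]

theorem coords_eq_trivialization {x₀ x : M} (h : x ∈ (chart x₀).source) (v : T3 x) :
    coords x₀ x v = (trivializationAt E3 (TangentSpace 𝓘(ℝ, E3) : M → Type) x₀ ⟨x, v⟩).2 := by
  rw [coords, Trivialization.continuousLinearMapAt_apply,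
    Trivialization.coe_linearMapAt_of_mem _ (mem_baseSet_iff.2 h)]

/-! ### Metric and Christoffel symbols in a chart. -/

variable [RiemannianBundle (fun x : M => TangentSpace 𝓘(ℝ, E3) x)]

/-- The metric in the chart around `x₀`. -/
def metricForm (x₀ : M) (y : E3) : E3 →ₗ[ℝ] E3 →ₗ[ℝ] ℝ :=
  bilinForm fun i j => metricCoeff x₀ y i j

/-- The Christoffel symbols in the chart around `x₀`, as a bilinear map. -/
def christoffelMap (x₀ : M) (y : E3) : E3 →ₗ[ℝ] E3 →ₗ[ℝ] E3 :=
  bilinMap fun k i j => christoffel x₀ k i j y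

/-- The derivative of the metric in direction `w`, in the chart around `x₀`. -/
def metricDeriv (x₀ : M) (y w : E3) : E3 →ₗ[ℝ] E3 →ₗ[ℝ] ℝ :=
  bilinForm fun i j => fderiv ℝ (fun z => metricCoeff x₀ z i j) y w

/-- The derivative of the Christoffel symbols in direction `w`, in the chart around `x₀`. -/
def christoffelDeriv (x₀ : M) (y w : E3) : E3 →ₗ[ℝ] E3 →ₗ[ℝ] E3 :=
  bilinMap fun k i j => fderiv ℝ (christoffel x₀ k i j) y w

theorem metricForm_apply (x₀ : M) (y u v : E3) :
    metricForm x₀ y u v = inner ℝ (ofCoords x₀ ((chart x₀).symm y) u)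
      (ofCoords x₀ ((chart x₀).symm y) v) := by
  have hw (w : E3) : ofCoords x₀ ((chart x₀).symm y) w =
      ∑ k, w k • coordField x₀ k ((chart x₀).symm y) := by
    rw [sum_smul_coordField]
  rw [metricForm, bilinForm_apply, hw u, hw v]
  simp only [sum_inner, inner_sum, inner_smul_left, inner_smul_right, metricCoeff,
    Finset.mul_sum]
  rw [Finset.sum_comm]
  refine Finset.sum_congr rfl fun i _ => Finset.sum_congr rfl fun j _ => ?_
  simp; ring

theorem metricForm_coords {x₀ x : M} (h : x ∈ (chart x₀).source) (u v : T3 x) :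
    metricForm x₀ (chart x₀ x) (coords x₀ x u) (coords x₀ x v) = inner ℝ u v := by
  rw [metricForm_apply]
  have hx : (chart x₀).symm (chart x₀ x) = x := (chart x₀).left_inv h
  rw [hx, ofCoords_coords h, ofCoords_coords h]

theorem metricForm_symm (x₀ : M) (y u v : E3) : metricForm x₀ y u v = metricForm x₀ y v u := by
  rw [metricForm_apply, metricForm_apply, real_inner_comm]

/-- Testing against `u` itself, positivity kills the tangent vector with coordinates `u`; over the
chart domain the trivialization is invertible, so `u` vanishes too. -/
theorem metricForm_nondegenerate {x₀ : M} {y : E3} (hy : y ∈ (chart x₀).target) {u : E3}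
    (h : ∀ v, metricForm x₀ y u v = 0) : u = 0 := by
  have h1 := h u
  rw [metricForm_apply, inner_self_eq_zero] at h1
  rw [← coords_ofCoords ((chart x₀).map_target hy) u, h1, map_zero]

theorem metricCoeff_symm (x₀ : M) (y : E3) (i j : Fin 3) :
    metricCoeff x₀ y i j = metricCoeff x₀ y j i := real_inner_comm _ _

/-- A kernel vector of the Gram matrix would be orthogonal to everything. This makes the matrix
inverse in `christoffel` a genuine inverse. -/
theorem isUnit_det_metricCoeff {x₀ : M} {y : E3} (hy : y ∈ (chart x₀).target) :
    IsUnit (metricCoeff x₀ y).det := by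
  rw [isUnit_iff_ne_zero]
  intro h0
  obtain ⟨v, hv, hv0⟩ := Matrix.exists_mulVec_eq_zero_iff.2 h0
  apply hv
  have : (WithLp.toLp 2 v : E3) = 0 := by
    refine metricForm_nondegenerate hy fun u => ?_
    rw [metricForm_symm, metricForm, bilinForm_apply]
    refine Finset.sum_eq_zero fun i _ => ?_
    have := congrFun hv0 i
    simp only [Matrix.mulVec, dotProduct, Pi.zero_apply] at this
    calc _ = u i * ∑ j, metricCoeff x₀ y i j * v j := by
          rw [Finset.mul_sum]; exact Finset.sum_congr rfl fun j _ => by simp; ring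
      _ = 0 := by rw [this, mul_zero]
  simpa using congrArg WithLp.ofLp this

theorem christoffelMap_symm (x₀ : M) (y u v : E3) :
    christoffelMap x₀ y u v = christoffelMap x₀ y v u := by
  ext k
  rw [christoffelMap, bilinMap_apply, bilinMap_apply, Finset.sum_comm]
  refine Finset.sum_congr rfl fun i _ => Finset.sum_congr rfl fun j _ => ?_
  have : christoffel x₀ k j i y = christoffel x₀ k i j y := by
    unfold christoffel
    congr 1
    refine Finset.sum_congr rfl fun l _ => ?_
    have : (fun z => metricCoeff x₀ z i j) = fun z => metricCoeff x₀ z j i :=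
      funext fun z => metricCoeff_symm x₀ z i j
    rw [this]; ring
  rw [this]; ring

theorem metricDeriv_eq {x₀ : M} {y : E3} (w u v : E3) :
    metricDeriv x₀ y w u v =
      ∑ i, ∑ j, ∑ k, pd k (fun z => metricCoeff x₀ z i j) y * (w k * u i * v j) := by
  rw [metricDeriv, bilinForm_apply]
  refine Finset.sum_congr rfl fun i _ => Finset.sum_congr rfl fun j _ => ?_
  rw [fderiv_eq_sum_pd, Finset.sum_mul]
  exact Finset.sum_congr rfl fun k _ => by ring

/-- The Koszul formula. -/
theorem koszul {x₀ : M} {y : E3} (hy : y ∈ (chart x₀).target) (u v w : E3) :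
    2 * metricForm x₀ y (christoffelMap x₀ y u v) w =
      metricDeriv x₀ y u v w + metricDeriv x₀ y v u w
        - metricDeriv x₀ y w u v := by
  -- Lowering the upper index of the Christoffel symbols cancels the inverse metric in their
  -- definition; the formula is then this identity contracted with `u`, `v`, `w`.
  have key (i j p : Fin 3) : ∑ k, metricCoeff x₀ y k p * christoffel x₀ k i j y =
      (1 / 2) * (pd i (fun z => metricCoeff x₀ z j p) y + pd j (fun z => metricCoeff x₀ z i p) y
        - pd p (fun z => metricCoeff x₀ z i j) y) := by
    set q : Fin 3 → ℝ := fun l => (1 / 2) * (pd i (fun z => metricCoeff x₀ z j l) y +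
      pd j (fun z => metricCoeff x₀ z i l) y - pd l (fun z => metricCoeff x₀ z i j) y) with hq
    have h1 (k : Fin 3) : christoffel x₀ k i j y = ((metricCoeff x₀ y)⁻¹.mulVec q) k := by
      simp only [christoffel, Matrix.mulVec, dotProduct, Finset.mul_sum, hq]
      exact Finset.sum_congr rfl fun l _ => by ring
    have h2 : (metricCoeff x₀ y).mulVec ((metricCoeff x₀ y)⁻¹.mulVec q) = q := by
      rw [Matrix.mulVec_mulVec, Matrix.mul_nonsing_inv _ (isUnit_det_metricCoeff hy),
        Matrix.one_mulVec]
    have h3 := congrFun h2 p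
    rw [Matrix.mulVec, dotProduct] at h3
    refine Eq.trans ?_ h3
    exact Finset.sum_congr rfl fun k _ => by rw [h1, metricCoeff_symm]
  rw [metricDeriv_eq, metricDeriv_eq, metricDeriv_eq]
  have hL : metricForm x₀ y (christoffelMap x₀ y u v) w =
      ∑ i, ∑ j, ∑ p, (∑ k, metricCoeff x₀ y k p * christoffel x₀ k i j y) * (u i * v j * w p) := by
    simp only [metricForm, bilinForm_apply, christoffelMap, bilinMap_apply, Fin.sum_univ_three]
    ring
  rw [hL]
  simp only [key, Fin.sum_univ_three]
  ring

/-- Metric compatibility in coordinates. Add the Koszul formulas for `(w, u; v)` and `(w, v; u)`: by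
symmetry of the metric the derivatives in the directions `u` and `v` cancel. -/
theorem metricDeriv_eq_christoffelMap {x₀ : M} {y : E3} (hy : y ∈ (chart x₀).target) (w u v : E3) :
    metricDeriv x₀ y w u v =
      metricForm x₀ y (christoffelMap x₀ y w u) v
        + metricForm x₀ y u (christoffelMap x₀ y w v) := by
  have h1 := koszul hy w u v
  have h2 := koszul hy w v u
  have hs (a b c : E3) : metricDeriv x₀ y a b c = metricDeriv x₀ y a c b := by
    rw [metricDeriv_eq, metricDeriv_eq, Finset.sum_comm]
    refine Finset.sum_congr rfl fun i _ => Finset.sum_congr rfl fun j _ =>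
      Finset.sum_congr rfl fun k _ => ?_
    have : (fun z => metricCoeff x₀ z i j) = fun z => metricCoeff x₀ z j i :=
      funext fun z => metricCoeff_symm x₀ z i j
    rw [this]; ring
  rw [metricForm_symm x₀ y u]
  rw [hs w v u, hs u w v, hs v w u] at *
  linarith

/-! ### Smoothness of the metric and of the Christoffel symbols. -/

variable [IsContMDiffRiemannianBundle 𝓘(ℝ, E3) ∞ E3 (fun x : M => TangentSpace 𝓘(ℝ, E3) x)]

/-- A coordinate field is constant in the trivialization of its own chart, hence a smooth section,
and the bundle metric of smooth sections is smooth. -/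
theorem contDiffAt_metricCoeff {x₀ : M} {y : E3} (hy : y ∈ (chart x₀).target) (i j : Fin 3) :
    ContDiffAt ℝ ∞ (fun z => metricCoeff x₀ z i j) y := by
  have hs (k : Fin 3) : ContMDiffAt 𝓘(ℝ, E3) (𝓘(ℝ, E3).prod 𝓘(ℝ, E3)) ∞
      (fun z : E3 => (TotalSpace.mk' E3 ((chart x₀).symm z) (coordField x₀ k ((chart x₀).symm z)) :
        TotalSpace E3 (TangentSpace 𝓘(ℝ, E3) : M → Type))) y := by
    rw [Trivialization.contMDiffAt_iff (e := trivializationAt E3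
      (TangentSpace 𝓘(ℝ, E3) : M → Type) x₀)]
    · refine ⟨(contMDiffOn_extChartAt_symm x₀).contMDiffAt ((isOpen_target x₀).mem_nhds hy), ?_⟩
      refine (contMDiffAt_const (c := (EuclideanSpace.single k 1 : E3))).congr_of_eventuallyEq ?_
      filter_upwards [(isOpen_target x₀).mem_nhds hy] with z hz
      rw [← coords_eq_trivialization ((chart x₀).map_target hz), coordField_eq,
        coords_ofCoords ((chart x₀).map_target hz)]
    · rw [Trivialization.mem_source]
      exact mem_baseSet_iff.2 ((chart x₀).map_target hy)
  exact (ContMDiffAt.inner_bundle (hs i) (hs j)).contDiffAt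

theorem contDiffAt_christoffel {x₀ : M} {y : E3} (hy : y ∈ (chart x₀).target) (k i j : Fin 3) :
    ContDiffAt ℝ ∞ (christoffel x₀ k i j) y := by
  -- Cramer's rule: the inverse is the adjugate over the determinant, and both are polynomial in the
  -- smooth entries.
  have hinv (k l : Fin 3) : ContDiffAt ℝ ∞ (fun z => (metricCoeff x₀ z)⁻¹ k l) y := by
    have hadj : ContDiffAt ℝ ∞ (fun z => (metricCoeff x₀ z).adjugate k l) y := by
      simp only [Matrix.adjugate_apply, Matrix.det_fin_three, Matrix.updateRow_apply]
      have := fun i j => contDiffAt_metricCoeff hy i j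
      have hc (i : Fin 3) : ContDiffAt ℝ ∞ (fun z : E3 => Pi.single (M := fun _ => ℝ) k 1 i) y :=
        contDiffAt_const
      have hcase (i j : Fin 3) : ContDiffAt ℝ ∞ (fun z : E3 => if i = l then
          Pi.single (M := fun _ => ℝ) k 1 j else metricCoeff x₀ z i j) y := by
        by_cases h : i = l
        · simpa [h] using hc j
        · simpa [h] using this i j
      fun_prop
    have hdet : ContDiffAt ℝ ∞ (fun z => (metricCoeff x₀ z).det) y := by
      simp only [Matrix.det_fin_three]
      have := fun i j => contDiffAt_metricCoeff hy i j
      fun_prop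
    refine ((hdet.inv (isUnit_det_metricCoeff hy).ne_zero).mul hadj).congr_of_eventuallyEq ?_
    filter_upwards with z
    simp [Matrix.inv_def]
  refine contDiffAt_const.mul (ContDiffAt.sum fun l _ => (hinv k l).mul ?_)
  exact ((contDiffAt_pd (contDiffAt_metricCoeff hy j l) i).add
    (contDiffAt_pd (contDiffAt_metricCoeff hy i l) j)).sub
    (contDiffAt_pd (contDiffAt_metricCoeff hy i j) l)

end

end Filament

end

noncomputable section

namespace Filament

theorem hasDerivAt_fderiv_apply {E F : Type*} [NormedAddCommGroup E] [NormedSpace ℝ E]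
    [NormedAddCommGroup F] [NormedSpace ℝ F] {φ : E → F} {y u : ℝ → E} {y' u' : E} {s : ℝ}
    (h : DifferentiableAt ℝ (fderiv ℝ φ) (y s)) (hy : HasDerivAt y y' s) (hu : HasDerivAt u u' s) :
    HasDerivAt (fun r => fderiv ℝ φ (y r) (u r))
      (fderiv ℝ (fderiv ℝ φ) (y s) y' (u s) + fderiv ℝ φ (y s) u') s := by
  have h1 : HasDerivAt (fderiv ℝ φ ∘ y) (fderiv ℝ (fderiv ℝ φ) (y s) y') s :=
    HasFDerivAt.comp_hasDerivAt (F := E) (E := E →L[ℝ] F) s h.hasFDerivAt hy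
  exact h1.clm_apply hu

/-! ### Change of charts -/

section

variable {M : Type*} [TopologicalSpace M] [ChartedSpace E3 M]

/-- The change of coordinates from the chart around `x₁` to the chart around `x₀`. -/
def transition (x₀ x₁ : M) (z : E3) : E3 := chart x₀ ((chart x₁).symm z)

/-- The domain of a change of coordinates. -/
def transitionSource (x₀ x₁ : M) : Set E3 :=
  (chart x₁).target ∩ (chart x₁).symm ⁻¹' (chart x₀).source

theorem chart_mem_transitionSource {x₀ x₁ x : M} (h₀ : x ∈ (chart x₀).source)
    (h₁ : x ∈ (chart x₁).source) : chart x₁ x ∈ transitionSource x₀ x₁ := by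
  refine ⟨(chart x₁).map_source h₁, ?_⟩
  rw [mem_preimage, (chart x₁).left_inv h₁]
  exact h₀

theorem transition_chart (x₀ : M) {x₁ x : M} (h₁ : x ∈ (chart x₁).source) :
    transition x₀ x₁ (chart x₁ x) = chart x₀ x := by
  rw [transition, (chart x₁).left_inv h₁]

theorem isOpen_transitionSource (x₀ x₁ : M) : IsOpen (transitionSource x₀ x₁) :=
  (continuousOn_extChartAt_symm x₁).isOpen_inter_preimage (isOpen_target x₁) (isOpen_source x₀)

theorem transition_mem_target {x₀ x₁ : M} {z : E3} (hz : z ∈ transitionSource x₀ x₁) :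
    transition x₀ x₁ z ∈ (chart x₀).target := (chart x₀).map_source hz.2

variable [IsManifold 𝓘(ℝ, E3) ∞ M]

theorem contDiffAt_transition {x₀ x₁ : M} {z : E3} (hz : z ∈ transitionSource x₀ x₁) :
    ContDiffAt ℝ ∞ (transition x₀ x₁) z := by
  have h1 : ContMDiffAt 𝓘(ℝ, E3) 𝓘(ℝ, E3) ∞ (chart x₁).symm z :=
    (contMDiffOn_extChartAt_symm x₁).contMDiffAt ((isOpen_target x₁).mem_nhds hz.1)
  have h2 : ContMDiffAt 𝓘(ℝ, E3) 𝓘(ℝ, E3) ∞ (chart x₀) ((chart x₁).symm z) :=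
    contMDiffAt_extChartAt' (by simpa using hz.2)
  exact (h2.comp z h1).contDiffAt

/-- Links calculus in charts with the tangent bundle: the Jacobian of a change of charts is the
bundle's coordinate change, and the latter factors through the chart at `x` by the cocycle identity.
-/
theorem fderiv_transition {x₀ x₁ x : M} (h₀ : x ∈ (chart x₀).source)
    (h₁ : x ∈ (chart x₁).source) (w : E3) :
    fderiv ℝ (transition x₀ x₁) (chart x₁ x) w = coords x₀ x (ofCoords x₁ x w) := by
  have h := hasFDerivWithinAt_tangentCoordChange (I := 𝓘(ℝ, E3)) (x := x₁) (y := x₀) (z := x)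
    ⟨h₁, h₀⟩
  rw [modelWithCornersSelf_coe, range_id, hasFDerivWithinAt_univ] at h
  have h' : fderiv ℝ (transition x₀ x₁) (chart x₁ x) = tangentCoordChange 𝓘(ℝ, E3) x₁ x₀ x :=
    h.fderiv
  rw [h', coords, ofCoords,
    TangentBundle.continuousLinearMapAt_trivializationAt_eq_core (by simpa using h₀),
    TangentBundle.symmL_trivializationAt_eq_core (by simpa using h₁)]
  exact (tangentCoordChange_comp ⟨⟨h₁, mem_source x⟩, h₀⟩).symm

theorem fderiv_transition_coords {x₀ x₁ x : M} (h₀ : x ∈ (chart x₀).source)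
    (h₁ : x ∈ (chart x₁).source) (v : T3 x) :
    fderiv ℝ (transition x₀ x₁) (chart x₁ x) (coords x₁ x v) = coords x₀ x v := by
  rw [fderiv_transition h₀ h₁, ofCoords_coords h₁]

theorem differentiableAt_fderiv_transition {x₀ x₁ : M} {z : E3}
    (hz : z ∈ transitionSource x₀ x₁) :
    DifferentiableAt ℝ (fderiv ℝ (transition x₀ x₁)) z :=
  ((contDiffAt_transition hz).fderiv_right (m := 1) (by norm_cast)).differentiableAt (by simp)

variable [RiemannianBundle (fun x : M => TangentSpace 𝓘(ℝ, E3) x)]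

theorem metricForm_transition {x₀ x₁ : M} {z : E3} (hz : z ∈ transitionSource x₀ x₁) (u v : E3) :
    metricForm x₀ (transition x₀ x₁ z) (fderiv ℝ (transition x₀ x₁) z u)
      (fderiv ℝ (transition x₀ x₁) z v) = metricForm x₁ z u v := by
  have h₁ := (chart x₁).map_target hz.1
  have h₀ := hz.2
  have h := fun w => fderiv_transition h₀ h₁ w
  rw [(chart x₁).right_inv hz.1] at h
  rw [h, h, metricForm_apply, metricForm_apply, transition, (chart x₀).left_inv h₀,
    ofCoords_coords h₀, ofCoords_coords h₀]

variable [IsContMDiffRiemannianBundle 𝓘(ℝ, E3) ∞ E3 (fun x : M => TangentSpace 𝓘(ℝ, E3) x)]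

theorem hasDerivAt_metricForm {x₀ : M} {y u v : ℝ → E3} {y' u' v' : E3} {s : ℝ}
    (h : y s ∈ (chart x₀).target) (hy : HasDerivAt y y' s)
    (hu : HasDerivAt u u' s) (hv : HasDerivAt v v' s) :
    HasDerivAt (fun r => metricForm x₀ (y r) (u r) (v r))
      (metricDeriv x₀ (y s) y' (u s) (v s)
        + metricForm x₀ (y s) u' (v s) + metricForm x₀ (y s) (u s) v') s :=
  hasDerivAt_bilinForm (fun i j => (contDiffAt_metricCoeff h i j).differentiableAt (by simp))
    hy hu hv

theorem hasDerivAt_christoffelMap {x₀ : M} {y u v : ℝ → E3} {y' u' v' : E3} {s : ℝ}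
    (h : y s ∈ (chart x₀).target) (hy : HasDerivAt y y' s)
    (hu : HasDerivAt u u' s) (hv : HasDerivAt v v' s) :
    HasDerivAt (fun r => christoffelMap x₀ (y r) (u r) (v r))
      (christoffelDeriv x₀ (y s) y' (u s) (v s)
        + christoffelMap x₀ (y s) u' (v s) + christoffelMap x₀ (y s) (u s) v') s :=
  hasDerivAt_bilinMap (c := fun z k i j => christoffel x₀ k i j z)
    (fun k i j => (contDiffAt_christoffel h k i j).differentiableAt (by simp))
    hy hu hv

/-- Differentiate `metricForm_transition` along the line `z + r • w`. The last two terms, from the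
second derivative of the change of charts, are what makes the Christoffel symbols non-tensorial. -/
theorem metricDeriv_transition {x₀ x₁ : M} {z : E3} (hz : z ∈ transitionSource x₀ x₁)
    (w u v : E3) :
    metricDeriv x₁ z w u v =
      metricDeriv x₀ (transition x₀ x₁ z) (fderiv ℝ (transition x₀ x₁) z w)
        (fderiv ℝ (transition x₀ x₁) z u) (fderiv ℝ (transition x₀ x₁) z v)
      + metricForm x₀ (transition x₀ x₁ z) (fderiv ℝ (fderiv ℝ (transition x₀ x₁)) z w u)
        (fderiv ℝ (transition x₀ x₁) z v)
      + metricForm x₀ (transition x₀ x₁ z) (fderiv ℝ (transition x₀ x₁) z u)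
        (fderiv ℝ (fderiv ℝ (transition x₀ x₁)) z w v) := by
  set φ := transition x₀ x₁ with hφ
  have hline : HasDerivAt (fun r : ℝ => z + r • w) w 0 := by
    simpa using ((hasDerivAt_id (0 : ℝ)).smul_const w).const_add z
  have h0 : z + (0 : ℝ) • w = z := by simp
  have h1 := hasDerivAt_metricForm (x₀ := x₁) (by simpa using hz.1) hline
    (hasDerivAt_const (0 : ℝ) u) (hasDerivAt_const (0 : ℝ) v)
  have hφz : HasFDerivAt φ (fderiv ℝ φ z) (z + (0 : ℝ) • w) := by
    rw [h0]; exact ((contDiffAt_transition hz).differentiableAt (by simp)).hasFDerivAt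
  have hy : HasDerivAt (fun r : ℝ => φ (z + r • w)) (fderiv ℝ φ z w) 0 :=
    HasFDerivAt.comp_hasDerivAt (l := φ) (0 : ℝ) hφz hline
  have hd (q : E3) : HasDerivAt (fun r : ℝ => fderiv ℝ φ (z + r • w) q)
      (fderiv ℝ (fderiv ℝ φ) z w q) 0 := by
    have := hasDerivAt_fderiv_apply (φ := φ) (y := fun r : ℝ => z + r • w) (s := 0)
      (by rw [h0]; exact differentiableAt_fderiv_transition hz) hline (hasDerivAt_const (0 : ℝ) q)
    simpa only [h0, map_zero, add_zero] using this
  have h2 := hasDerivAt_metricForm (x₀ := x₀) (y := fun r : ℝ => φ (z + r • w)) (s := 0)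
    (by simpa using transition_mem_target hz) hy (hd u) (hd v)
  have heq : (fun r : ℝ => metricForm x₀ (φ (z + r • w)) (fderiv ℝ φ (z + r • w) u)
      (fderiv ℝ φ (z + r • w) v)) =ᶠ[𝓝 0] fun r => metricForm x₁ (z + r • w) u v := by
    have : ∀ᶠ r in 𝓝 (0 : ℝ), z + r • w ∈ transitionSource x₀ x₁ :=
      hline.continuousAt.eventually ((isOpen_transitionSource x₀ x₁).mem_nhds (by simpa using hz))
    filter_upwards [this] with r hr using metricForm_transition hr u v
  have := h1.unique (h2.congr_of_eventuallyEq heq.symm)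
  simpa only [h0, map_zero, LinearMap.zero_apply, add_zero] using this

/-- The transformation law of the Christoffel symbols. -/
theorem christoffelMap_transition {x₀ x₁ : M} {z : E3} (hz : z ∈ transitionSource x₀ x₁)
    (u v : E3) :
    fderiv ℝ (transition x₀ x₁) z (christoffelMap x₁ z u v) =
      christoffelMap x₀ (transition x₀ x₁ z) (fderiv ℝ (transition x₀ x₁) z u)
        (fderiv ℝ (transition x₀ x₁) z v)
      + fderiv ℝ (fderiv ℝ (transition x₀ x₁)) z u v := by
  have h₁ := (chart x₁).map_target hz.1
  have h₀ := hz.2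
  have hsymm (a b : E3) : fderiv ℝ (fderiv ℝ (transition x₀ x₁)) z a b =
      fderiv ℝ (fderiv ℝ (transition x₀ x₁)) z b a :=
    ((contDiffAt_transition hz).isSymmSndFDerivAt (by simp; norm_cast)).eq _ _
  rw [← sub_eq_zero]
  refine metricForm_nondegenerate (transition_mem_target hz) fun q => ?_
  -- The Jacobian is onto, so it suffices to test against its values, where the Koszul formulas of
  -- both charts apply.
  obtain ⟨w, rfl⟩ : ∃ w, fderiv ℝ (transition x₀ x₁) z w = q := by
    refine ⟨coords x₁ ((chart x₁).symm z) (ofCoords x₀ ((chart x₁).symm z) q), ?_⟩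
    have h := fderiv_transition h₀ h₁
    rw [(chart x₁).right_inv hz.1] at h
    rw [h, ofCoords_coords h₁, coords_ofCoords h₀]
  have k1 := koszul hz.1 u v w
  have k0 := koszul (transition_mem_target hz) (fderiv ℝ (transition x₀ x₁) z u)
    (fderiv ℝ (transition x₀ x₁) z v) (fderiv ℝ (transition x₀ x₁) z w)
  -- The Koszul combination contains six second-derivative terms. By symmetry four of them cancel,
  -- and the other two both pair the second derivative at `(u, v)` with the image of `w`.
  rw [← metricForm_transition hz, metricDeriv_transition hz, metricDeriv_transition hz,
    metricDeriv_transition hz, hsymm w u, hsymm w v, hsymm v u,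
    metricForm_symm _ _ _ (fderiv ℝ (fderiv ℝ (transition x₀ x₁)) z u w),
    metricForm_symm _ _ _ (fderiv ℝ (fderiv ℝ (transition x₀ x₁)) z v w)] at k1
  simp only [map_sub, map_add, LinearMap.sub_apply, LinearMap.add_apply]
  have := metricForm_symm x₀ (transition x₀ x₁ z) (fderiv ℝ (fderiv ℝ (transition x₀ x₁)) z v w)
    (fderiv ℝ (transition x₀ x₁) z u)
  linarith

end

end Filament

end

noncomputable section

namespace Filament

/-! ### Covariant derivatives along curves -/

section

variable {M : Type*} [TopologicalSpace M] [ChartedSpace E3 M]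

theorem eventually_mem_source {γ : ℝ → M} {s : ℝ}
    (h : MDifferentiableAt 𝓘(ℝ, ℝ) 𝓘(ℝ, E3) γ s) {x₀ : M}
    (h₀ : γ s ∈ (chart x₀).source) : ∀ᶠ r in 𝓝 s, γ r ∈ (chart x₀).source :=
  h.continuousAt.eventually ((isOpen_source x₀).mem_nhds h₀)

variable [IsManifold 𝓘(ℝ, E3) ∞ M]

/-- Differentiability of a vector field along a curve. -/
structure DiffAlong (γ : ℝ → M) (V : ∀ s, T3 (γ s)) (s : ℝ) : Prop where
  curve : MDifferentiableAt 𝓘(ℝ, ℝ) 𝓘(ℝ, E3) γ s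
  field : DifferentiableAt ℝ (fun r => coords (γ s) (γ r) (V r)) s

variable {γ : ℝ → M} {V W : ∀ s, T3 (γ s)} {s : ℝ}

theorem hasDerivAt_chart_comp (h : MDifferentiableAt 𝓘(ℝ, ℝ) 𝓘(ℝ, E3) γ s) {x₀ : M}
    (h₀ : γ s ∈ (chart x₀).source) :
    HasDerivAt (fun r => chart x₀ (γ r)) (coords x₀ (γ s) (velocity γ s)) s := by
  have h₀' : γ s ∈ (chartAt E3 x₀).source := by simpa using h₀
  have h1 : MDifferentiableAt 𝓘(ℝ, E3) 𝓘(ℝ, E3) (chart x₀) (γ s) := mdifferentiableAt_extChartAt h₀'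
  have h2 : coords x₀ (γ s) (velocity γ s) = fderiv ℝ (fun r => chart x₀ (γ r)) s 1 := by
    have h3 := mfderiv_comp s h1 h
    rw [mfderiv_eq_fderiv] at h3
    rw [coords, TangentBundle.continuousLinearMapAt_trivializationAt h₀']
    exact (congrArg (fun l : ℝ →L[ℝ] E3 => l 1) h3).symm
  rw [h2]
  have h3 : DifferentiableAt ℝ (fun r => chart x₀ (γ r)) s :=
    (h1.comp s h).differentiableAt
  exact h3.hasDerivAt

theorem DiffAlong.smul {f : ℝ → ℝ} (h : DiffAlong γ V s) (hf : DifferentiableAt ℝ f s) :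
    DiffAlong γ (fun r => f r • V r) s :=
  ⟨h.curve, by simpa only [map_smul] using! hf.fun_smul h.field⟩

theorem DiffAlong.add (h : DiffAlong γ V s) (h' : DiffAlong γ W s) :
    DiffAlong γ (fun r => V r + W r) s :=
  ⟨h.curve, by simpa only [map_add] using! h.field.fun_add h'.field⟩

variable [RiemannianBundle (fun x : M => TangentSpace 𝓘(ℝ, E3) x)]

theorem coords_covDeriv_self (h : DiffAlong γ V s) :
    coords (γ s) (γ s) (covDeriv γ V s) = deriv (fun r => coords (γ s) (γ r) (V r)) s +
      christoffelMap (γ s) (chart (γ s) (γ s)) (coords (γ s) (γ s) (velocity γ s))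
        (coords (γ s) (γ s) (V s)) := by
  rw [covDeriv, sum_smul_coordField, coords_ofCoords (mem_source _)]
  ext k
  rw [PiLp.add_apply, christoffelMap, bilinMap_apply]
  simp only [coord_eq]
  rw [(HasDerivAt.euclidean_apply h.field.hasDerivAt k).deriv]
  simp only [mul_assoc]

variable [IsContMDiffRiemannianBundle 𝓘(ℝ, E3) ∞ E3 (fun x : M => TangentSpace 𝓘(ℝ, E3) x)]

/-- The coordinate expression of the covariant derivative, in any chart. -/
theorem DiffAlong.hasDerivAt (h : DiffAlong γ V s) {x₀ : M} (h₀ : γ s ∈ (chart x₀).source) :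
    HasDerivAt (fun r => coords x₀ (γ r) (V r))
      (coords x₀ (γ s) (covDeriv γ V s) - christoffelMap x₀ (chart x₀ (γ s))
        (coords x₀ (γ s) (velocity γ s)) (coords x₀ (γ s) (V s))) s := by
  set x₁ := γ s with hx₁
  have h₁ : γ s ∈ (chart x₁).source := mem_source _
  have hz : chart x₁ (γ s) ∈ transitionSource x₀ x₁ := chart_mem_transitionSource h₀ h₁
  have hy := hasDerivAt_chart_comp h.curve h₁
  have hw : HasDerivAt (fun r => coords x₁ (γ r) (V r)) _ s := h.field.hasDerivAt
  have hd := hasDerivAt_fderiv_apply (φ := transition x₀ x₁)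
    (differentiableAt_fderiv_transition hz) hy hw
  have heq : (fun r => coords x₀ (γ r) (V r)) =ᶠ[𝓝 s] fun r =>
      fderiv ℝ (transition x₀ x₁) (chart x₁ (γ r)) (coords x₁ (γ r) (V r)) := by
    filter_upwards [eventually_mem_source h.curve h₀, eventually_mem_source h.curve h₁]
      with r hr0 hr1
    rw [fderiv_transition_coords hr0 hr1]
  convert! hd.congr_of_eventuallyEq heq using 1
  -- The derivative in the chart around `γ s` is pushed to the chart around `x₀` by the Jacobian.
  -- The second derivative of the transition produced by the product rule cancels the inhomogeneous
  -- term of the Christoffel law.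
  have hc := coords_covDeriv_self h
  have ht := christoffelMap_transition hz (coords x₁ (γ s) (velocity γ s)) (coords x₁ (γ s) (V s))
  rw [transition_chart _ h₁, fderiv_transition_coords h₀ h₁, fderiv_transition_coords h₀ h₁] at ht
  change coords x₁ (γ s) _ = _ + christoffelMap x₁ (chart x₁ (γ s)) _ _ at hc
  have h1 := fderiv_transition_coords h₀ h₁ (covDeriv γ V s)
  rw [hc, map_add, ht] at h1
  rw [← h1]
  abel

theorem DiffAlong.coords_covDeriv (h : DiffAlong γ V s) {x₀ : M} (h₀ : γ s ∈ (chart x₀).source) :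
    coords x₀ (γ s) (covDeriv γ V s) = deriv (fun r => coords x₀ (γ r) (V r)) s +
      christoffelMap x₀ (chart x₀ (γ s)) (deriv (fun r => chart x₀ (γ r)) s)
        (coords x₀ (γ s) (V s)) := by
  rw [(h.hasDerivAt h₀).deriv, (hasDerivAt_chart_comp h.curve h₀).deriv]
  abel

theorem covDeriv_smul {f : ℝ → ℝ} (h : DiffAlong γ V s) (hf : DifferentiableAt ℝ f s) :
    covDeriv γ (fun r => f r • V r) s = deriv f s • V s + f s • covDeriv γ V s := by
  have h₀ := mem_source (γ s)
  have h1 := (h.smul hf).hasDerivAt h₀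
  have h2 := hf.hasDerivAt.smul (h.hasDerivAt h₀)
  simp only [map_smul] at h1
  have h3 := h1.unique h2
  refine coords_injective h₀ ?_
  rw [map_add, map_smul, map_smul]
  rw [sub_eq_iff_eq_add] at h3
  rw [h3, smul_sub]
  abel

theorem covDeriv_add (h : DiffAlong γ V s) (h' : DiffAlong γ W s) :
    covDeriv γ (fun r => V r + W r) s = covDeriv γ V s + covDeriv γ W s := by
  have h₀ := mem_source (γ s)
  have h1 := (h.add h').hasDerivAt h₀
  have h2 := (h.hasDerivAt h₀).add (h'.hasDerivAt h₀)
  simp only [map_add] at h1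
  have h3 := h1.unique h2
  refine coords_injective h₀ ?_
  rw [map_add]
  rw [sub_eq_iff_eq_add] at h3
  rw [h3]
  abel

/-- The Levi-Civita connection is compatible with the metric. -/
theorem hasDerivAt_inner (h : DiffAlong γ V s) (h' : DiffAlong γ W s) :
    HasDerivAt (fun r => inner ℝ (V r) (W r))
      (inner ℝ (covDeriv γ V s) (W s) + inner ℝ (V s) (covDeriv γ W s)) s := by
  have h₀ := mem_source (γ s)
  have ht := (chart (γ s)).map_source h₀
  have h1 := hasDerivAt_metricForm (y := fun r => chart (γ s) (γ r)) ht
    (hasDerivAt_chart_comp h.curve h₀) (h.hasDerivAt h₀) (h'.hasDerivAt h₀)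
  have heq : (fun r => inner ℝ (V r) (W r)) =ᶠ[𝓝 s] fun r =>
      metricForm (γ s) (chart (γ s) (γ r)) (coords (γ s) (γ r) (V r))
        (coords (γ s) (γ r) (W r)) := by
    filter_upwards [eventually_mem_source h.curve h₀] with r hr
    rw [metricForm_coords hr]
  convert! h1.congr_of_eventuallyEq heq using 1
  -- Metric compatibility in coordinates: the derivative of the metric coefficients cancels the two
  -- Christoffel corrections.
  rw [metricDeriv_eq_christoffelMap ht, ← metricForm_coords h₀, ← metricForm_coords h₀]
  simp only [map_sub, LinearMap.sub_apply]
  ring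

end

end Filament

end

noncomputable section

namespace Filament

/-! ### Partial derivatives of functions of two real variables -/

section Partial

variable {F : Type*} [NormedAddCommGroup F] [NormedSpace ℝ F] {f : ℝ × ℝ → F} {t s : ℝ}

theorem hasDerivAt_partial_snd (h : DifferentiableAt ℝ f (t, s)) :
    HasDerivAt (fun r => f (t, r)) (fderiv ℝ f (t, s) (0, 1)) s :=
  h.hasFDerivAt.comp_hasDerivAt (f := fun r : ℝ => (t, r)) s
    ((hasDerivAt_const s t).prodMk (hasDerivAt_id s))

theorem hasDerivAt_partial_fst (h : DifferentiableAt ℝ f (t, s)) :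
    HasDerivAt (fun r => f (r, s)) (fderiv ℝ f (t, s) (1, 0)) t :=
  h.hasFDerivAt.comp_hasDerivAt (f := fun r : ℝ => (r, s)) t
    ((hasDerivAt_id t).prodMk (hasDerivAt_const t s))

theorem eventually_differentiableAt {p : ℝ × ℝ} (h : ContDiffAt ℝ ∞ f p) :
    ∀ᶠ q in 𝓝 p, DifferentiableAt ℝ f q := by
  have h1 : ContDiffAt ℝ 1 f p := h.of_le (by simp)
  filter_upwards [h1.eventually (by simp)] with q hq using hq.differentiableAt (by simp)

theorem partial_snd_eventuallyEq {p : ℝ × ℝ} (h : ContDiffAt ℝ ∞ f p) :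
    (fun q : ℝ × ℝ => deriv (fun r => f (q.1, r)) q.2) =ᶠ[𝓝 p] fun q => fderiv ℝ f q (0, 1) := by
  filter_upwards [eventually_differentiableAt h] with q hq
    using (hasDerivAt_partial_snd (t := q.1) (s := q.2) hq).deriv

theorem partial_fst_eventuallyEq {p : ℝ × ℝ} (h : ContDiffAt ℝ ∞ f p) :
    (fun q : ℝ × ℝ => deriv (fun r => f (r, q.2)) q.1) =ᶠ[𝓝 p] fun q => fderiv ℝ f q (1, 0) := by
  filter_upwards [eventually_differentiableAt h] with q hq
    using (hasDerivAt_partial_fst (t := q.1) (s := q.2) hq).deriv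

theorem ContDiffAt.fderiv_const_apply {p : ℝ × ℝ} (h : ContDiffAt ℝ ∞ f p) (v : ℝ × ℝ) :
    ContDiffAt ℝ ∞ (fun q => fderiv ℝ f q v) p :=
  (h.fderiv_right (m := ∞) (by simp)).clm_apply contDiffAt_const

theorem contDiffAt_partial_snd {p : ℝ × ℝ} (h : ContDiffAt ℝ ∞ f p) :
    ContDiffAt ℝ ∞ (fun q : ℝ × ℝ => deriv (fun r => f (q.1, r)) q.2) p :=
  (ContDiffAt.fderiv_const_apply h (0, 1)).congr_of_eventuallyEq (partial_snd_eventuallyEq h)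

theorem contDiffAt_partial_fst {p : ℝ × ℝ} (h : ContDiffAt ℝ ∞ f p) :
    ContDiffAt ℝ ∞ (fun q : ℝ × ℝ => deriv (fun r => f (r, q.2)) q.1) p :=
  (ContDiffAt.fderiv_const_apply h (1, 0)).congr_of_eventuallyEq (partial_fst_eventuallyEq h)

theorem fderiv_fderiv_const_apply {p : ℝ × ℝ} (h : ContDiffAt ℝ ∞ f p) (v w : ℝ × ℝ) :
    fderiv ℝ (fun q => fderiv ℝ f q v) p w = fderiv ℝ (fderiv ℝ f) p w v := by
  have h1 : DifferentiableAt ℝ (fderiv ℝ f) p :=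
    (h.fderiv_right (m := ∞) (by simp)).differentiableAt (by simp)
  have := h1.hasFDerivAt.clm_apply (hasFDerivAt_const v p)
  rw [this.fderiv]
  simp

theorem contDiff_swap_prod : ContDiff ℝ ∞ (Prod.swap : ℝ × ℝ → ℝ × ℝ) :=
  contDiff_snd.prodMk contDiff_fst

/-- Schwarz's theorem for iterated one-variable derivatives: near the point each slice derivative is
a directional value of `fderiv`, so both sides are values of the symmetric second derivative. -/
theorem partial_comm (h : ContDiffAt ℝ ∞ f (t, s)) :
    deriv (fun r => deriv (fun t' => f (t', r)) t) s =
      deriv (fun t' => deriv (fun r => f (t', r)) s) t := by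
  have h1 : (fun r => deriv (fun t' => f (t', r)) t) =ᶠ[𝓝 s] fun r => fderiv ℝ f (t, r) (1, 0) :=
    (Continuous.tendsto (f := fun r : ℝ => (t, r)) (by fun_prop) s).eventually
      (partial_fst_eventuallyEq h)
  have h2 : (fun t' => deriv (fun r => f (t', r)) s) =ᶠ[𝓝 t] fun t' => fderiv ℝ f (t', s) (0, 1) :=
    (Continuous.tendsto (f := fun r : ℝ => (r, s)) (by fun_prop) t).eventually
      (partial_snd_eventuallyEq h)
  rw [h1.deriv_eq, h2.deriv_eq, (hasDerivAt_partial_snd (f := fun q => fderiv ℝ f q (1, 0))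
      ((ContDiffAt.fderiv_const_apply h (1, 0)).differentiableAt (by simp))).deriv,
    (hasDerivAt_partial_fst (f := fun q => fderiv ℝ f q (0, 1))
      ((ContDiffAt.fderiv_const_apply h (0, 1)).differentiableAt (by simp))).deriv,
    fderiv_fderiv_const_apply h, fderiv_fderiv_const_apply h]
  exact (h.isSymmSndFDerivAt (by simp; norm_cast)).eq _ _

end Partial

/-! ### Vector fields along two-parameter maps -/

section

variable {M : Type*} [TopologicalSpace M] [ChartedSpace E3 M]

theorem eventually_mem_source_uncurry {a : ℝ → ℝ → M} {x₀ : M} {p : ℝ × ℝ}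
    (h : ContMDiffAt 𝓘(ℝ, ℝ × ℝ) 𝓘(ℝ, E3) ∞ (fun q : ℝ × ℝ => a q.1 q.2) p)
    (h₀ : a p.1 p.2 ∈ (chart x₀).source) :
    ∀ᶠ q : ℝ × ℝ in 𝓝 p, a q.1 q.2 ∈ (chart x₀).source :=
  h.continuousAt.eventually ((isOpen_source x₀).mem_nhds h₀)

theorem mdifferentiableAt_snd {a : ℝ → ℝ → M} {t s : ℝ}
    (h : ContMDiffAt 𝓘(ℝ, ℝ × ℝ) 𝓘(ℝ, E3) ∞ (fun q : ℝ × ℝ => a q.1 q.2) (t, s)) :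
    MDifferentiableAt 𝓘(ℝ, ℝ) 𝓘(ℝ, E3) (a t) s := by
  have h1 : ContMDiffAt 𝓘(ℝ, ℝ) 𝓘(ℝ, ℝ × ℝ) ∞ (fun r : ℝ => (t, r)) s :=
    (contDiff_const.prodMk contDiff_id).contMDiff.contMDiffAt
  exact (ContMDiffAt.comp (f := fun r : ℝ => (t, r)) s h h1).mdifferentiableAt (by simp)

variable [IsManifold 𝓘(ℝ, E3) ∞ M]

/-- Smoothness of a vector field along a map of two real variables. -/
def SmoothField (a : ℝ → ℝ → M) (U : Set (ℝ × ℝ)) (V : ∀ t s, T3 (a t s)) : Prop :=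
  ∀ p ∈ U, ContMDiffAt 𝓘(ℝ, ℝ × ℝ) (𝓘(ℝ, E3).prod 𝓘(ℝ, E3)) ∞
    (fun q : ℝ × ℝ => (TotalSpace.mk' E3 (a q.1 q.2) (V q.1 q.2) :
      TotalSpace E3 (TangentSpace 𝓘(ℝ, E3) : M → Type))) p

/-- The velocity of the curves `s ↦ a t s`. -/
def velSnd (a : ℝ → ℝ → M) (t s : ℝ) : T3 (a t s) := velocity (a t) s

/-- The velocity of the curves `t ↦ a t s`. -/
def velFst (a : ℝ → ℝ → M) (t s : ℝ) : T3 (a t s) := velocity (fun t' => a t' s) t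

variable {a : ℝ → ℝ → M} {U : Set (ℝ × ℝ)} {V W : ∀ t s, T3 (a t s)} {t s : ℝ} {x₀ : M}

theorem smoothField_iff : SmoothField a U V ↔ ∀ p ∈ U,
    ContMDiffAt 𝓘(ℝ, ℝ × ℝ) 𝓘(ℝ, E3) ∞ (fun q : ℝ × ℝ => a q.1 q.2) p ∧
    ContDiffAt ℝ ∞ (fun q : ℝ × ℝ => coords (a p.1 p.2) (a q.1 q.2) (V q.1 q.2)) p := by
  refine forall₂_congr fun p _ => ?_
  rw [contMDiffAt_totalSpace, ← contMDiffAt_iff_contDiffAt]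
  refine and_congr_right fun h => ?_
  refine Filter.EventuallyEq.contMDiffAt_iff ?_
  filter_upwards [h.continuousAt.eventually ((isOpen_source _).mem_nhds (mem_source (a p.1 p.2)))]
    with q hq
  rw [coords_eq_trivialization hq]

theorem SmoothField.contMDiffAt (h : SmoothField a U V) {p : ℝ × ℝ} (hp : p ∈ U) :
    ContMDiffAt 𝓘(ℝ, ℝ × ℝ) 𝓘(ℝ, E3) ∞ (fun q : ℝ × ℝ => a q.1 q.2) p :=
  (smoothField_iff.1 h p hp).1

theorem contDiffAt_chart {p : ℝ × ℝ}
    (h : ContMDiffAt 𝓘(ℝ, ℝ × ℝ) 𝓘(ℝ, E3) ∞ (fun q : ℝ × ℝ => a q.1 q.2) p)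
    (h₀ : a p.1 p.2 ∈ (chart x₀).source) :
    ContDiffAt ℝ ∞ (fun q : ℝ × ℝ => chart x₀ (a q.1 q.2)) p := by
  have h2 : ContMDiffAt 𝓘(ℝ, E3) 𝓘(ℝ, E3) ∞ (chart x₀) (a p.1 p.2) :=
    contMDiffAt_extChartAt' (by simpa using h₀)
  exact (ContMDiffAt.comp p h2 h).contDiffAt

theorem SmoothField.contDiffAt (h : SmoothField a U V) {p : ℝ × ℝ} (hp : p ∈ U)
    (h₀ : a p.1 p.2 ∈ (chart x₀).source) :
    ContDiffAt ℝ ∞ (fun q : ℝ × ℝ => coords x₀ (a q.1 q.2) (V q.1 q.2)) p := by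
  have h1 := h p hp
  rw [Trivialization.contMDiffAt_iff (e := trivializationAt E3
      (TangentSpace 𝓘(ℝ, E3) : M → Type) x₀)
      ((Trivialization.mem_source _).2 (mem_baseSet_iff.2 h₀))] at h1
  refine h1.2.contDiffAt.congr_of_eventuallyEq ?_
  filter_upwards [eventually_mem_source_uncurry h1.1 h₀] with q hq
  rw [coords_eq_trivialization hq]

/-- Exchanging the variables lets results about the second variable be reused for the first. -/
theorem SmoothField.swap (h : SmoothField a U V) :
    SmoothField (fun s t => a t s) (Prod.swap ⁻¹' U) (fun s t => V t s) := fun p hp =>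
  ContMDiffAt.comp (f := (Prod.swap : ℝ × ℝ → ℝ × ℝ)) p (h p.swap hp)
    contDiff_swap_prod.contMDiff.contMDiffAt

theorem SmoothField.smul {f : ℝ → ℝ → ℝ} (h : SmoothField a U V)
    (hf : ∀ p ∈ U, ContDiffAt ℝ ∞ (fun q : ℝ × ℝ => f q.1 q.2) p) :
    SmoothField a U (fun t s => f t s • V t s) := by
  rw [smoothField_iff] at *
  intro p hp
  refine ⟨(h p hp).1, ?_⟩
  simp only [map_smul]
  exact (hf p hp).smul (h p hp).2

theorem SmoothField.diffAlong_snd (h : SmoothField a U V) (hp : (t, s) ∈ U) :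
    DiffAlong (a t) (V t) s :=
  ⟨mdifferentiableAt_snd (h.contMDiffAt hp), (hasDerivAt_partial_snd
    ((h.contDiffAt hp (mem_source (a t s))).differentiableAt (by simp))).differentiableAt⟩

theorem SmoothField.diffAlong_fst (h : SmoothField a U V) (hp : (t, s) ∈ U) :
    DiffAlong (fun t' => a t' s) (fun t' => V t' s) t :=
  h.swap.diffAlong_snd (t := s) (s := t) hp

theorem smoothField_velSnd (hU : IsOpen U)
    (h : ∀ p ∈ U, ContMDiffAt 𝓘(ℝ, ℝ × ℝ) 𝓘(ℝ, E3) ∞ (fun q : ℝ × ℝ => a q.1 q.2) p) :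
    SmoothField a U (velSnd a) := by
  rw [smoothField_iff]
  intro p hp
  refine ⟨h p hp, ?_⟩
  refine (contDiffAt_partial_snd (contDiffAt_chart (h p hp) (mem_source _))).congr_of_eventuallyEq ?_
  filter_upwards [eventually_mem_source_uncurry (h p hp) (mem_source _), hU.mem_nhds hp] with q hq hqU
  exact (hasDerivAt_chart_comp (mdifferentiableAt_snd (h q hqU)) hq).deriv.symm

theorem smoothField_velFst (hU : IsOpen U)
    (h : ∀ p ∈ U, ContMDiffAt 𝓘(ℝ, ℝ × ℝ) 𝓘(ℝ, E3) ∞ (fun q : ℝ × ℝ => a q.1 q.2) p) :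
    SmoothField a U (velFst a) :=
  (smoothField_velSnd (a := fun s t => a t s) (hU.preimage continuous_swap) fun p hp =>
    ContMDiffAt.comp (f := (Prod.swap : ℝ × ℝ → ℝ × ℝ)) p (h p.swap hp)
    contDiff_swap_prod.contMDiff.contMDiffAt).swap

variable [RiemannianBundle (fun x : M => TangentSpace 𝓘(ℝ, E3) x)]

/-- The covariant derivative in the second variable. -/
def covSnd (a : ℝ → ℝ → M) (V : ∀ t s, T3 (a t s)) (t s : ℝ) : T3 (a t s) :=
  covDeriv (a t) (V t) s

/-- The covariant derivative in the first variable. -/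
def covFst (a : ℝ → ℝ → M) (V : ∀ t s, T3 (a t s)) (t s : ℝ) : T3 (a t s) :=
  covDeriv (fun t' => a t' s) (fun t' => V t' s) t

variable [IsContMDiffRiemannianBundle 𝓘(ℝ, E3) ∞ E3 (fun x : M => TangentSpace 𝓘(ℝ, E3) x)]

theorem SmoothField.contDiffAt_inner (hV : SmoothField a U V) (hW : SmoothField a U W)
    {p : ℝ × ℝ} (hp : p ∈ U) :
    ContDiffAt ℝ ∞ (fun q : ℝ × ℝ => (inner ℝ (V q.1 q.2) (W q.1 q.2) : ℝ)) p :=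
  (ContMDiffAt.inner_bundle (hV p hp) (hW p hp)).contDiffAt

/-- Here chart independence is used: `covDeriv` works at each `q` in the chart around the moving
point, yet near `p` its coordinates in one fixed chart obey one formula, which can be differentiated
again. -/
theorem SmoothField.coords_covSnd_eventuallyEq (hU : IsOpen U) (h : SmoothField a U V) {p : ℝ × ℝ}
    (hp : p ∈ U) (h₀ : a p.1 p.2 ∈ (chart x₀).source) :
    (fun q : ℝ × ℝ => coords x₀ (a q.1 q.2) (covSnd a V q.1 q.2)) =ᶠ[𝓝 p] fun q =>
      deriv (fun r => coords x₀ (a q.1 r) (V q.1 r)) q.2 +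
        christoffelMap x₀ (chart x₀ (a q.1 q.2)) (deriv (fun r => chart x₀ (a q.1 r)) q.2)
          (coords x₀ (a q.1 q.2) (V q.1 q.2)) := by
  filter_upwards [eventually_mem_source_uncurry (h.contMDiffAt hp) h₀, hU.mem_nhds hp] with q hq hqU
  exact (h.diffAlong_snd hqU).coords_covDeriv hq

theorem SmoothField.covSnd (hU : IsOpen U) (h : SmoothField a U V) :
    SmoothField a U (covSnd a V) := by
  rw [smoothField_iff]
  intro p hp
  refine ⟨h.contMDiffAt hp, ?_⟩
  have h₀ := mem_source (a p.1 p.2)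
  refine ContDiffAt.congr_of_eventuallyEq ?_ (h.coords_covSnd_eventuallyEq hU hp h₀)
  have hy := contDiffAt_chart (h.contMDiffAt hp) h₀
  have hv := h.contDiffAt hp h₀
  have hΓ (k i j : Fin 3) : ContDiffAt ℝ ∞ (fun q : ℝ × ℝ =>
      christoffel (a p.1 p.2) k i j (chart (a p.1 p.2) (a q.1 q.2))) p :=
    ContDiffAt.comp (g := christoffel (a p.1 p.2) k i j)
      (f := fun q : ℝ × ℝ => chart (a p.1 p.2) (a q.1 q.2)) p
      (contDiffAt_christoffel ((chart _).map_source h₀) k i j) hy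
  exact (contDiffAt_partial_snd hv).add (contDiffAt_bilinMap hΓ (contDiffAt_partial_snd hy) hv)

theorem SmoothField.covFst (hU : IsOpen U) (h : SmoothField a U V) :
    SmoothField a U (covFst a V) :=
  (h.swap.covSnd (hU.preimage continuous_swap)).swap

end

end Filament

end

noncomputable section

namespace Filament

/-! ### Torsion-freeness and curvature -/

section

variable {M : Type*} [TopologicalSpace M] [ChartedSpace E3 M] [IsManifold 𝓘(ℝ, E3) ∞ M]
  [RiemannianBundle (fun x : M => TangentSpace 𝓘(ℝ, E3) x)]

/-- The curvature in the coordinates of the chart around `x₀`. -/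
def curvatureMap (x₀ : M) (y u v w : E3) : E3 :=
  christoffelDeriv x₀ y v u w - christoffelDeriv x₀ y u v w
    + christoffelMap x₀ y v (christoffelMap x₀ y u w)
    - christoffelMap x₀ y u (christoffelMap x₀ y v w)

theorem coords_riemann {x : M} (X Y Z : T3 x) :
    coords x x (riemann X Y Z) =
      curvatureMap x (chart x x) (coords x x X) (coords x x Y) (coords x x Z) := by
  rw [riemann, sum_smul_coordField, coords_ofCoords (mem_source x)]
  ext m
  simp only [curvatureMap, PiLp.add_apply, PiLp.sub_apply, christoffelDeriv, christoffelMap,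
    bilinMap_apply, coord_eq, curvatureCoeff, fderiv_eq_sum_pd, Fin.sum_univ_three]
  ring

theorem riemann_antisymm {x : M} (X Y Z : T3 x) : riemann X Y Z = -riemann Y X Z := by
  refine coords_injective (mem_source x) ?_
  rw [map_neg, coords_riemann, coords_riemann, curvatureMap, curvatureMap]
  abel

theorem christoffelDeriv_symm (x₀ : M) (y w u v : E3) :
    christoffelDeriv x₀ y w u v = christoffelDeriv x₀ y w v u := by
  ext k
  rw [christoffelDeriv, bilinMap_apply, bilinMap_apply, Finset.sum_comm]
  refine Finset.sum_congr rfl fun i _ => Finset.sum_congr rfl fun j _ => ?_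
  have : christoffel x₀ k j i = christoffel x₀ k i j := by
    ext z
    have h := congrArg (fun w : E3 => w k) (christoffelMap_symm x₀ z
      (EuclideanSpace.single j 1) (EuclideanSpace.single i 1))
    simpa [christoffelMap, bilinMap_apply, Pi.single_apply] using h
  rw [this]; ring

/-- The first Bianchi identity. -/
theorem riemann_bianchi {x : M} (X Y Z : T3 x) :
    riemann X Y Z + riemann Y Z X + riemann Z X Y = 0 := by
  refine coords_injective (mem_source x) ?_
  rw [map_add, map_add, map_zero, coords_riemann, coords_riemann, coords_riemann, curvatureMap,
    curvatureMap, curvatureMap]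
  generalize coords x x X = u
  generalize coords x x Y = v
  generalize coords x x Z = w
  -- Once the symmetric lower indices are put in a common order, the cyclic sum cancels term by
  -- term.
  rw [christoffelMap_symm x _ w v, christoffelMap_symm x _ w u, christoffelMap_symm x _ v u,
    christoffelDeriv_symm x _ v u w, christoffelDeriv_symm x _ u v w,
    christoffelDeriv_symm x _ w v u]
  abel

theorem riemann_add_left {x : M} (X X' Y Z : T3 x) :
    riemann (X + X') Y Z = riemann X Y Z + riemann X' Y Z := by
  simp only [riemann, coord_eq, map_add, PiLp.add_apply, add_mul, mul_add,
    Finset.sum_add_distrib, add_smul]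

theorem riemann_add_right {x : M} (X Y Z Z' : T3 x) :
    riemann X Y (Z + Z') = riemann X Y Z + riemann X Y Z' := by
  simp only [riemann, coord_eq, map_add, PiLp.add_apply, mul_add,
    Finset.sum_add_distrib, add_smul]

theorem riemann_smul_middle {x : M} (c : ℝ) (X Y Z : T3 x) :
    riemann X (c • Y) Z = c • riemann X Y Z := by
  simp only [riemann, Finset.smul_sum, ← mul_smul]
  refine Finset.sum_congr rfl fun m _ => ?_
  congr 1
  simp only [coord_eq, map_smul, PiLp.smul_apply, smul_eq_mul, Finset.mul_sum]
  refine Finset.sum_congr rfl fun i _ => Finset.sum_congr rfl fun j _ =>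
    Finset.sum_congr rfl fun k _ => ?_
  ring

theorem curv_eq_of_constant {K₀ : ℝ} (h : HasConstantCurvature M K₀) {x : M} {X Y : T3 x}
    (hX : ‖X‖ = 1) (hY : ‖Y‖ = 1) (hXY : inner ℝ X Y = 0) : curv X Y X Y = K₀ := by
  have hlin : LinearIndependent ℝ ![X, Y] := by
    refine Orthonormal.linearIndependent ⟨?_, ?_⟩
    · intro i; fin_cases i <;> simp [hX, hY]
    · intro i j hij
      fin_cases i <;> fin_cases j <;> simp_all [real_inner_comm]
  have := h x X Y hlin
  simpa [sectionalCurvature, hX, hY, hXY] using this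

variable [IsContMDiffRiemannianBundle 𝓘(ℝ, E3) ∞ E3 (fun x : M => TangentSpace 𝓘(ℝ, E3) x)]

/-- Skew-adjointness of `R(u, v)`. Differentiate metric compatibility for direction `c` once more in
direction `b` and antisymmetrize in `b`, `c`: the second derivatives of the metric drop out by
symmetry, and the rest is the stated sum. -/
theorem metricForm_curvatureMap {x₀ : M} {y : E3} (hy : y ∈ (chart x₀).target) (u v w z : E3) :
    metricForm x₀ y (curvatureMap x₀ y u v w) z + metricForm x₀ y w (curvatureMap x₀ y u v z)
      = 0 := by
  have hline (b : E3) : HasDerivAt (fun r : ℝ => y + r • b) b 0 := by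
    simpa using ((hasDerivAt_id (0 : ℝ)).smul_const b).const_add y
  have h0 (b : E3) : y + (0 : ℝ) • b = y := by simp
  -- the derivative of `metricDeriv` is symmetric in the two directions
  have hsecond (b c : E3) : HasDerivAt (fun r : ℝ => metricDeriv x₀ (y + r • b) c w z)
      (bilinForm (fun i j => fderiv ℝ (fderiv ℝ fun z => metricCoeff x₀ z i j) y b c) w z) 0 := by
    simp only [metricDeriv, bilinForm_apply]
    refine HasDerivAt.fun_sum fun i _ => HasDerivAt.fun_sum fun j _ => HasDerivAt.mul_const ?_ _
    have hd : DifferentiableAt ℝ (fderiv ℝ fun z => metricCoeff x₀ z i j) (y + (0 : ℝ) • b) := by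
      rw [h0]
      exact ((contDiffAt_metricCoeff hy i j).fderiv_right (m := ∞)
        (by simp)).differentiableAt (by simp)
    have := hasDerivAt_fderiv_apply hd (hline b) (hasDerivAt_const (0 : ℝ) c)
    simpa only [h0, map_zero, add_zero] using this
  have hexpand (b c : E3) : bilinForm
      (fun i j => fderiv ℝ (fderiv ℝ fun z => metricCoeff x₀ z i j) y b c) w z =
      metricDeriv x₀ y b (christoffelMap x₀ y c w) z
      + metricForm x₀ y (christoffelDeriv x₀ y b c w) z
      + (metricDeriv x₀ y b w (christoffelMap x₀ y c z)
      + metricForm x₀ y w (christoffelDeriv x₀ y b c z)) := by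
    have hΓ (q : E3) := hasDerivAt_christoffelMap (x₀ := x₀) (y := fun r : ℝ => y + r • b)
      (by simpa using hy) (hline b) (hasDerivAt_const (0 : ℝ) c) (hasDerivAt_const (0 : ℝ) q)
    have h1 := (hasDerivAt_metricForm (x₀ := x₀) (y := fun r : ℝ => y + r • b)
      (by simpa using hy) (hline b) (hΓ w) (hasDerivAt_const (0 : ℝ) z)).add
      (hasDerivAt_metricForm (x₀ := x₀) (y := fun r : ℝ => y + r • b)
      (by simpa using hy) (hline b) (hasDerivAt_const (0 : ℝ) w) (hΓ z))
    have heq : (fun r : ℝ => metricDeriv x₀ (y + r • b) c w z) =ᶠ[𝓝 0] fun r =>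
        metricForm x₀ (y + r • b) (christoffelMap x₀ (y + r • b) c w) z
        + metricForm x₀ (y + r • b) w (christoffelMap x₀ (y + r • b) c z) := by
      have : ∀ᶠ r in 𝓝 (0 : ℝ), y + r • b ∈ (chart x₀).target :=
        (hline b).continuousAt.eventually ((isOpen_target x₀).mem_nhds (by simpa using hy))
      filter_upwards [this] with r hr using metricDeriv_eq_christoffelMap hr c w z
    have := (hsecond b c).unique (h1.congr_of_eventuallyEq heq)
    simpa only [h0, map_zero, LinearMap.zero_apply, add_zero] using this
  have hsymm : bilinForm (fun i j => fderiv ℝ (fderiv ℝ fun z => metricCoeff x₀ z i j) y v u) w z =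
      bilinForm (fun i j => fderiv ℝ (fderiv ℝ fun z => metricCoeff x₀ z i j) y u v) w z := by
    have : (fun i j => fderiv ℝ (fderiv ℝ fun z => metricCoeff x₀ z i j) y v u) =
        fun i j => fderiv ℝ (fderiv ℝ fun z => metricCoeff x₀ z i j) y u v := by
      funext i j
      exact ((contDiffAt_metricCoeff hy i j).isSymmSndFDerivAt (by simp; norm_cast)).eq _ _
    rw [this]
  rw [hexpand, hexpand] at hsymm
  simp only [metricDeriv_eq_christoffelMap hy] at hsymm
  simp only [curvatureMap, map_add, map_sub, LinearMap.add_apply, LinearMap.sub_apply]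
  linarith

theorem curv_antisymm_right {x : M} (X Y Z W : T3 x) : curv X Y Z W = -curv X Y W Z := by
  have h := metricForm_curvatureMap ((chart x).map_source (mem_source x)) (coords x x X)
    (coords x x Y) (coords x x Z) (coords x x W)
  rw [← coords_riemann, ← coords_riemann, metricForm_coords (mem_source x),
    metricForm_coords (mem_source x)] at h
  rw [curv, curv, real_inner_comm Z (riemann X Y W)]
  linarith

/-- The symmetry of the curvature under exchange of the two pairs of arguments. -/
theorem curv_pair_symm {x : M} (X Y Z W : T3 x) : curv X Y Z W = curv Z W X Y := by
  have hb (X Y Z W : T3 x) : curv X Y Z W + curv Y Z X W + curv Z X Y W = 0 := by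
    rw [curv, curv, curv, ← inner_add_left, ← inner_add_left, riemann_bianchi, inner_zero_left]
  have ha (X Y Z W : T3 x) : curv X Y Z W = -curv Y X Z W := by
    rw [curv, curv, riemann_antisymm, inner_neg_left]
  have hc := curv_antisymm_right (x := x)
  -- The classical octahedron argument: four Bianchi identities, with cyclically shifted arguments,
  -- combined through antisymmetry in each pair.
  linarith [hb X Y Z W, hb Y Z W X, hb Z W X Y, hb W X Y Z, ha X Y Z W, ha Y Z W X, ha Z W X Y,
    ha W X Y Z, ha Z X Y W, ha W Y Z X, ha X Z W Y, ha Y W X Z, hc X Y Z W, hc Y Z X W, hc Z X Y W,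
    hc Y Z W X, hc Z W Y X, hc W Y Z X, hc Z W X Y, hc W X Z Y, hc X Z W Y, hc W X Y Z, hc X Y W Z,
    hc Y W X Z]

/-- Polarization: `X + Z` is orthogonal to `Y` with squared norm `2`, so `2K₀ = K₀ + K₀ + 2
(X,Y,Z,Y)`, where pair symmetry identifies the two cross terms. -/
theorem curv_polarized_of_constant {K₀ : ℝ} (h : HasConstantCurvature M K₀) {x : M}
    {X Y Z : T3 x} (hX : ‖X‖ = 1) (hY : ‖Y‖ = 1) (hZ : ‖Z‖ = 1) (hXY : inner ℝ X Y = 0)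
    (hXZ : inner ℝ X Z = 0) (hYZ : inner ℝ Y Z = 0) : curv X Y Z Y = 0 := by
  have hXZn : ‖X + Z‖ ^ 2 = 2 := by
    rw [norm_add_sq_real, hX, hZ, hXZ]; norm_num
  have hXZY : inner ℝ (X + Z) Y = 0 := by
    rw [inner_add_left, hXY, real_inner_comm, hYZ, add_zero]
  have hlin : LinearIndependent ℝ ![X + Z, Y] := by
    refine linearIndependent_of_ne_zero_of_inner_eq_zero (𝕜 := ℝ) ?_ ?_
    · intro i
      fin_cases i
      · intro h0
        have h0 : X + Z = 0 := h0
        rw [h0] at hXZn; simp at hXZn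
      · intro h0
        have h0 : Y = 0 := h0
        rw [h0] at hY; simp at hY
    · intro i j hij
      fin_cases i <;> fin_cases j <;> simp_all [real_inner_comm]
  have h1 := h x _ _ hlin
  rw [sectionalCurvature, hXZn, hY, hXZY] at h1
  have h2 := curv_eq_of_constant h hX hY hXY
  have h3 := curv_eq_of_constant h hZ hY (by rw [real_inner_comm, hYZ])
  have h4 : curv (X + Z) Y (X + Z) Y = curv X Y X Y + curv Z Y X Y + curv X Y Z Y + curv Z Y Z Y := by
    simp only [curv, riemann_add_left, riemann_add_right, inner_add_left]
    ring
  rw [h4, h2, h3, curv_pair_symm Z Y X Y] at h1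
  linarith

/-! ### Commuting covariant derivatives along a two-parameter map. -/

variable {a : ℝ → ℝ → M} {U : Set (ℝ × ℝ)} {V W : ∀ t s, T3 (a t s)} {t s : ℝ}

/-- Torsion-freeness: in a chart both sides are a mixed second partial derivative plus the
Christoffel map of the two velocities, and both terms are symmetric. -/
theorem covSnd_velFst (hU : IsOpen U)
    (h : ∀ p ∈ U, ContMDiffAt 𝓘(ℝ, ℝ × ℝ) 𝓘(ℝ, E3) ∞ (fun q : ℝ × ℝ => a q.1 q.2) p)
    (hp : (t, s) ∈ U) : covSnd a (velFst a) t s = covFst a (velSnd a) t s := by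
  have h₀ := mem_source (a t s)
  have hF := (smoothField_velFst hU h).diffAlong_snd hp
  have hS := (smoothField_velSnd hU h).diffAlong_fst hp
  have hev := (eventually_mem_source_uncurry (h _ hp) h₀).and (hU.mem_nhds hp)
  have hy := contDiffAt_chart (h _ hp) h₀
  have hyS {t s : ℝ} (hp : (t, s) ∈ U) {x₀ : M} (h₀ : a t s ∈ (chart x₀).source) :
      coords x₀ (a t s) (velSnd a t s) = deriv (fun r => chart x₀ (a t r)) s :=
    (hasDerivAt_chart_comp (mdifferentiableAt_snd (h _ hp)) h₀).deriv.symm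
  have hyF {t s : ℝ} (hp : (t, s) ∈ U) {x₀ : M} (h₀ : a t s ∈ (chart x₀).source) :
      coords x₀ (a t s) (velFst a t s) = deriv (fun r => chart x₀ (a r s)) t :=
    (hasDerivAt_chart_comp ((smoothField_velFst hU h).diffAlong_fst hp).curve h₀).deriv.symm
  refine coords_injective h₀ ?_
  have e1 : coords (a t s) (a t s) (covSnd a (velFst a) t s) = _ := hF.coords_covDeriv h₀
  have e2 : coords (a t s) (a t s) (covFst a (velSnd a) t s) = _ := hS.coords_covDeriv h₀
  rw [e1, e2, hyS hp h₀, hyF hp h₀, christoffelMap_symm]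
  congr 1
  have h1 : (fun r => coords (a t s) (a t r) (velFst a t r)) =ᶠ[𝓝 s]
      fun r => deriv (fun t' => chart (a t s) (a t' r)) t := by
    filter_upwards [(Continuous.tendsto (f := fun r : ℝ => (t, r)) (by fun_prop) s).eventually hev]
      with r hr using hyF hr.2 hr.1
  have h2 : (fun t' => coords (a t s) (a t' s) (velSnd a t' s)) =ᶠ[𝓝 t]
      fun t' => deriv (fun r => chart (a t s) (a t' r)) s := by
    filter_upwards [(Continuous.tendsto (f := fun r : ℝ => (r, s)) (by fun_prop) t).eventually hev]
      with r hr using hyS hr.2 hr.1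
  rw [h1.deriv_eq, h2.deriv_eq]
  exact partial_comm (f := fun q : ℝ × ℝ => chart (a t s) (a q.1 q.2)) hy

/-- The full chart expansion of a second covariant derivative. Applied also with the variables
exchanged, it reduces the commutator to a subtraction. -/
theorem SmoothField.covFst_covSnd_coords (hU : IsOpen U) (hV : SmoothField a U V)
    (hp : (t, s) ∈ U) :
    coords (a t s) (a t s) (Filament.covFst a (Filament.covSnd a V) t s) =
      deriv (fun t' => deriv (fun r => coords (a t s) (a t' r) (V t' r)) s) t
      + (christoffelDeriv (a t s) (chart (a t s) (a t s)) (coords (a t s) (a t s) (velFst a t s))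
          (coords (a t s) (a t s) (velSnd a t s)) (coords (a t s) (a t s) (V t s))
        + christoffelMap (a t s) (chart (a t s) (a t s))
          (deriv (fun t' => deriv (fun r => chart (a t s) (a t' r)) s) t)
          (coords (a t s) (a t s) (V t s))
        + christoffelMap (a t s) (chart (a t s) (a t s)) (coords (a t s) (a t s) (velSnd a t s))
          (deriv (fun t' => coords (a t s) (a t' s) (V t' s)) t))
      + christoffelMap (a t s) (chart (a t s) (a t s)) (coords (a t s) (a t s) (velFst a t s))
        (deriv (fun r => coords (a t s) (a t r) (V t r)) s
          + christoffelMap (a t s) (chart (a t s) (a t s)) (coords (a t s) (a t s) (velSnd a t s))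
            (coords (a t s) (a t s) (V t s))) := by
  have h₀ := mem_source (a t s)
  have hy := contDiffAt_chart (hV.contMDiffAt hp) h₀
  have hv := hV.contDiffAt hp h₀
  have hyS : HasDerivAt (fun r => chart (a t s) (a t r)) _ s :=
    hasDerivAt_chart_comp (mdifferentiableAt_snd (hV.contMDiffAt hp)) h₀
  have hyF := hasDerivAt_chart_comp (hV.diffAlong_fst hp).curve h₀
  have e1 : coords (a t s) (a t s) (Filament.covFst a (Filament.covSnd a V) t s) = _ :=
    ((hV.covSnd hU).diffAlong_fst hp).coords_covDeriv h₀
  have e2 : coords (a t s) (a t s) (Filament.covSnd a V t s) = _ :=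
    (hV.diffAlong_snd hp).coords_covDeriv h₀
  have h1 := (Continuous.tendsto (f := fun r : ℝ => (r, s)) (by fun_prop) t).eventually
    (hV.coords_covSnd_eventuallyEq hU hp h₀)
  have h1 : (fun t' => coords (a t s) (a t' s) (Filament.covSnd a V t' s)) =ᶠ[𝓝 t] _ := h1
  have h2 := (hasDerivAt_partial_fst ((contDiffAt_partial_snd hv).differentiableAt
    (by simp))).differentiableAt.hasDerivAt
  have h3 := (hasDerivAt_partial_fst ((contDiffAt_partial_snd hy).differentiableAt
    (by simp))).differentiableAt.hasDerivAt
  have h4 := (hasDerivAt_partial_fst (hv.differentiableAt (by simp))).differentiableAt.hasDerivAt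
  have h5 := h2.add (hasDerivAt_christoffelMap ((chart (a t s)).map_source h₀) hyF h3 h4)
  have h6 := (h5.congr_of_eventuallyEq h1).deriv
  rw [e1, e2, h6, hyF.deriv, hyS.deriv]
  rfl

/-- The curvature is the commutator of the covariant derivatives along a two-parameter map. -/
theorem SmoothField.covFst_covSnd_sub (hU : IsOpen U) (hV : SmoothField a U V)
    (hp : (t, s) ∈ U) :
    Filament.covFst a (Filament.covSnd a V) t s - Filament.covSnd a (Filament.covFst a V) t s =
      riemann (velSnd a t s) (velFst a t s) (V t s) := by
  have h₀ := mem_source (a t s)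
  refine coords_injective h₀ ?_
  have e1 := hV.covFst_covSnd_coords hU hp
  have e2 := hV.swap.covFst_covSnd_coords (hU.preimage continuous_swap) (t := s) (s := t) hp
  have e2' : coords (a t s) (a t s) (Filament.covSnd a (Filament.covFst a V) t s) = _ := e2
  rw [map_sub, e1, e2', coords_riemann, curvatureMap]
  have c1 := partial_comm (f := fun q : ℝ × ℝ => chart (a t s) (a q.1 q.2))
    (contDiffAt_chart (hV.contMDiffAt hp) h₀)
  have c2 := partial_comm (f := fun q : ℝ × ℝ => coords (a t s) (a q.1 q.2) (V q.1 q.2))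
    (hV.contDiffAt hp h₀)
  dsimp only at c1 c2
  rw [c1, c2]
  simp only [map_add]
  -- In the exchanged expansion the two velocities carry each other's names; restating them lets
  -- `abel` match the terms.
  change _ + _ + _ - (_ + (christoffelDeriv (a t s) (chart (a t s) (a t s))
    (coords (a t s) (a t s) (velSnd a t s)) (coords (a t s) (a t s) (velFst a t s)) _ + _ +
    christoffelMap (a t s) _ (coords (a t s) (a t s) (velFst a t s)) _) +
    (christoffelMap (a t s) _ (coords (a t s) (a t s) (velSnd a t s)) _ +
      christoffelMap (a t s) _ (coords (a t s) (a t s) (velSnd a t s))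
        (christoffelMap (a t s) _ (coords (a t s) (a t s) (velFst a t s)) _))) = _
  abel

end

end Filament

end

noncomputable section

namespace Filament

/-! ### Orthonormal frames of an oriented Euclidean three-space -/

section Frame

variable {V : Type*} [NormedAddCommGroup V] [InnerProductSpace ℝ V]
  [Fact (Module.finrank ℝ V = 3)] (o : Orientation ℝ V (Fin 3)) {T N B : V}

theorem inner_cross_left (u v : V) : inner ℝ (cross o u v) u = 0 := by
  rw [inner_cross]
  exact o.volumeForm.map_eq_zero_of_eq _ (i := 0) (j := 2) rfl (by decide)

theorem inner_cross_right (u v : V) : inner ℝ (cross o u v) v = 0 := by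
  rw [inner_cross]
  exact o.volumeForm.map_eq_zero_of_eq _ (i := 1) (j := 2) rfl (by decide)

theorem abs_volumeForm_of_orthogonal (hTN : inner ℝ T N = 0) (hBT : inner ℝ B T = 0)
    (hBN : inner ℝ B N = 0) : |o.volumeForm ![T, N, B]| = ‖T‖ * ‖N‖ * ‖B‖ := by
  rw [o.abs_volumeForm_apply_of_pairwise_orthogonal, Fin.prod_univ_three]
  · rfl
  · intro i j hij
    fin_cases i <;> fin_cases j <;> simp_all [real_inner_comm]

/-- For the cross product `c`, `|vol(T, N, c)|` is both `‖c‖²` and `‖T‖‖N‖‖c‖ = ‖c‖`, so `‖c‖` is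
`0` or `1`. In dimension three some `w ≠ 0` is orthogonal to `T` and `N`, and `|vol(T, N, w)| = ‖w‖`
excludes `0`. -/
theorem norm_cross (hT : ‖T‖ = 1) (hN : ‖N‖ = 1) (hTN : inner ℝ T N = 0) :
    ‖cross o T N‖ = 1 := by
  have hfin : FiniteDimensional ℝ V := FiniteDimensional.of_fact_finrank_eq_succ 2
  obtain ⟨w, hw, hwT, hwN⟩ : ∃ w : V, w ≠ 0 ∧ inner ℝ w T = 0 ∧ inner ℝ w N = 0 := by
    set S : Submodule ℝ V := Submodule.span ℝ (Set.range ![T, N])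
    have hS : S ≠ ⊤ := by
      intro h
      have h1 : Module.finrank ℝ S ≤ Fintype.card (Fin 2) :=
        finrank_range_le_card (R := ℝ) ![T, N]
      have h2 := Fact.out (p := Module.finrank ℝ V = 3)
      rw [h, finrank_top, h2, Fintype.card_fin] at h1
      omega
    have hne : Sᗮ ≠ ⊥ := fun h => hS (Submodule.orthogonal_eq_bot_iff.1 h)
    obtain ⟨w, hwS, hw0⟩ := Submodule.exists_mem_ne_zero_of_ne_bot hne
    rw [Submodule.mem_orthogonal'] at hwS
    exact ⟨w, hw0, hwS _ (Submodule.subset_span ⟨0, rfl⟩), hwS _ (Submodule.subset_span ⟨1, rfl⟩)⟩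
  have hne : cross o T N ≠ 0 := by
    intro h
    have h1 := abs_volumeForm_of_orthogonal o hTN hwT hwN
    rw [← inner_cross, h, inner_zero_left, hT, hN] at h1
    simp at h1
    exact hw (norm_eq_zero.1 h1.symm)
  have h1 := abs_volumeForm_of_orthogonal o hTN (inner_cross_left o T N) (inner_cross_right o T N)
  rw [← inner_cross, real_inner_self_eq_norm_sq, hT, hN, abs_of_nonneg (sq_nonneg _)] at h1
  have := norm_ne_zero_iff.2 hne
  field_simp at h1
  linarith

theorem eq_of_inner_frame (hT : ‖T‖ = 1) (hN : ‖N‖ = 1) (hB : ‖B‖ = 1) (hTN : inner ℝ T N = 0)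
    (hBT : inner ℝ B T = 0) (hBN : inner ℝ B N = 0) (v : V) :
    v = (inner ℝ v T : ℝ) • T + (inner ℝ v N : ℝ) • N + (inner ℝ v B : ℝ) • B := by
  have hfin : FiniteDimensional ℝ V := FiniteDimensional.of_fact_finrank_eq_succ 2
  have ho : Orthonormal ℝ ![T, N, B] := by
    refine ⟨?_, ?_⟩
    · intro i; fin_cases i <;> simp [hT, hN, hB]
    · intro i j hij
      fin_cases i <;> fin_cases j <;> simp_all [real_inner_comm]
  have hspan : ⊤ ≤ Submodule.span ℝ (Set.range ![T, N, B]) := by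
    rw [ho.linearIndependent.span_eq_top_of_card_eq_finrank' (by
      rw [Fintype.card_fin, Fact.out (p := Module.finrank ℝ V = 3)])]
  have h := (OrthonormalBasis.mk ho hspan).sum_repr' v
  rw [Fin.sum_univ_three] at h
  conv_lhs => rw [← h]
  simp [real_inner_comm v]

end Frame

/-! ### Fields along two-parameter maps: congruence and product rules -/

section

variable {M : Type*} [TopologicalSpace M] [ChartedSpace E3 M] [IsManifold 𝓘(ℝ, E3) ∞ M]
  {a : ℝ → ℝ → M} {U : Set (ℝ × ℝ)} {V W : ∀ t s, T3 (a t s)} {t s : ℝ}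

theorem eventually_mem_snd (hU : IsOpen U) (hp : (t, s) ∈ U) : ∀ᶠ r in 𝓝 s, (t, r) ∈ U :=
  (Continuous.tendsto (f := fun r : ℝ => (t, r)) (by fun_prop) s).eventually (hU.mem_nhds hp)

theorem eventually_mem_fst (hU : IsOpen U) (hp : (t, s) ∈ U) : ∀ᶠ r in 𝓝 t, (r, s) ∈ U :=
  (Continuous.tendsto (f := fun r : ℝ => (r, s)) (by fun_prop) t).eventually (hU.mem_nhds hp)

theorem SmoothField.congr (hU : IsOpen U) (h : SmoothField a U V)
    (heq : ∀ t s, (t, s) ∈ U → W t s = V t s) : SmoothField a U W := fun p hp => by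
  refine (h p hp).congr_of_eventuallyEq ?_
  filter_upwards [hU.mem_nhds hp] with q hq
  rw [heq q.1 q.2 hq]

variable [RiemannianBundle (fun x : M => TangentSpace 𝓘(ℝ, E3) x)]

theorem covDeriv_congr {γ : ℝ → M} {V W : ∀ s, T3 (γ s)} (h : ∀ᶠ r in 𝓝 s, V r = W r) :
    covDeriv γ V s = covDeriv γ W s := by
  have hk (k : Fin 3) : (fun r => coord (γ s) k (γ r) (V r)) =ᶠ[𝓝 s]
      fun r => coord (γ s) k (γ r) (W r) := by
    filter_upwards [h] with r hr
    rw [hr]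
  simp only [covDeriv, (hk _).deriv_eq, h.self_of_nhds]

theorem covSnd_congr (hU : IsOpen U) (h : ∀ t s, (t, s) ∈ U → V t s = W t s) (hp : (t, s) ∈ U) :
    covSnd a V t s = covSnd a W t s :=
  covDeriv_congr ((eventually_mem_snd hU hp).mono fun r hr => h t r hr)

theorem covFst_congr (hU : IsOpen U) (h : ∀ t s, (t, s) ∈ U → V t s = W t s) (hp : (t, s) ∈ U) :
    covFst a V t s = covFst a W t s :=
  covDeriv_congr ((eventually_mem_fst hU hp).mono fun r hr => h r s hr)

variable [IsContMDiffRiemannianBundle 𝓘(ℝ, E3) ∞ E3 (fun x : M => TangentSpace 𝓘(ℝ, E3) x)]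

theorem SmoothField.hasDerivAt_inner_snd (hV : SmoothField a U V) (hW : SmoothField a U W)
    (hp : (t, s) ∈ U) : HasDerivAt (fun r => (inner ℝ (V t r) (W t r) : ℝ))
      (inner ℝ (Filament.covSnd a V t s) (W t s) + inner ℝ (V t s) (Filament.covSnd a W t s)) s :=
  hasDerivAt_inner (hV.diffAlong_snd hp) (hW.diffAlong_snd hp)

theorem SmoothField.hasDerivAt_inner_fst (hV : SmoothField a U V) (hW : SmoothField a U W)
    (hp : (t, s) ∈ U) : HasDerivAt (fun r => (inner ℝ (V r s) (W r s) : ℝ))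
      (inner ℝ (Filament.covFst a V t s) (W t s) + inner ℝ (V t s) (Filament.covFst a W t s)) t :=
  hasDerivAt_inner (hV.diffAlong_fst hp) (hW.diffAlong_fst hp)

/-- Applied to the constant inner products of the Frenet frame, this supplies the skew-symmetry
behind the Frenet equations. -/
theorem SmoothField.inner_covSnd_of_const (hU : IsOpen U) (hV : SmoothField a U V)
    (hW : SmoothField a U W) {c : ℝ} (hc : ∀ t s, (t, s) ∈ U → inner ℝ (V t s) (W t s) = c)
    (hp : (t, s) ∈ U) :
    inner ℝ (Filament.covSnd a V t s) (W t s) + inner ℝ (V t s) (Filament.covSnd a W t s)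
      = (0 : ℝ) := by
  refine (hV.hasDerivAt_inner_snd hW hp).unique
    ((hasDerivAt_const s c).congr_of_eventuallyEq ?_)
  filter_upwards [eventually_mem_snd hU hp] with r hr using hc t r hr

theorem SmoothField.inner_covFst_of_const (hU : IsOpen U) (hV : SmoothField a U V)
    (hW : SmoothField a U W) {c : ℝ} (hc : ∀ t s, (t, s) ∈ U → inner ℝ (V t s) (W t s) = c)
    (hp : (t, s) ∈ U) :
    inner ℝ (Filament.covFst a V t s) (W t s) + inner ℝ (V t s) (Filament.covFst a W t s)
      = (0 : ℝ) := by
  refine (hV.hasDerivAt_inner_fst hW hp).unique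
    ((hasDerivAt_const t c).congr_of_eventuallyEq ?_)
  filter_upwards [eventually_mem_fst hU hp] with r hr using hc r s hr

end

end Filament

end

noncomputable section

namespace Filament

/-! ### Evolution of curvature and torsion under the vortex filament equation -/

section

variable {M : Type*} [TopologicalSpace M] [ChartedSpace E3 M] [IsManifold 𝓘(ℝ, E3) ∞ M]
  [RiemannianBundle (fun x : M => TangentSpace 𝓘(ℝ, E3) x)]

/-- A smooth family `a t` of unit speed curves with nonvanishing curvature which solves the vortex
filament equation, for `(t, s)` in the open set `U`. -/
structure IsVortexFilament (o : ∀ x : M, Orientation ℝ (T3 x) (Fin 3)) (a : ℝ → ℝ → M)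
    (U : Set (ℝ × ℝ)) : Prop where
  isOpen : IsOpen U
  contMDiffAt : ∀ p ∈ U, ContMDiffAt 𝓘(ℝ, ℝ × ℝ) 𝓘(ℝ, E3) ∞ (fun q : ℝ × ℝ => a q.1 q.2) p
  norm_velocity : ∀ t s, (t, s) ∈ U → ‖velSnd a t s‖ = 1
  curvature_ne_zero : ∀ t s, (t, s) ∈ U → curvature (a t) s ≠ 0
  evolution : ∀ t s, (t, s) ∈ U → velFst a t s = curvature (a t) s • binormal o (a t) s

namespace IsVortexFilament

variable {o : ∀ x : M, Orientation ℝ (T3 x) (Fin 3)} {a : ℝ → ℝ → M} {U : Set (ℝ × ℝ)} {t s : ℝ}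

theorem smooth_tangent (h : IsVortexFilament o a U) : SmoothField a U (velSnd a) :=
  smoothField_velSnd h.isOpen h.contMDiffAt

theorem covSnd_tangent (h : IsVortexFilament o a U) (t s : ℝ) (hp : (t, s) ∈ U) :
    covSnd a (velSnd a) t s = curvature (a t) s • normal (a t) s := by
  rw [normal, smul_smul, mul_inv_cancel₀ (h.curvature_ne_zero t s hp), one_smul]
  rfl

theorem norm_normal (h : IsVortexFilament o a U) (t s : ℝ) (hp : (t, s) ∈ U) :
    ‖normal (a t) s‖ = 1 := by
  have h1 := h.curvature_ne_zero t s hp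
  rw [normal, norm_smul, norm_inv, Real.norm_of_nonneg (show 0 ≤ curvature (a t) s from norm_nonneg _)]
  exact inv_mul_cancel₀ h1

theorem inner_tangent_tangent (h : IsVortexFilament o a U) (t s : ℝ) (hp : (t, s) ∈ U) :
    inner ℝ (velSnd a t s) (velSnd a t s) = (1 : ℝ) := by
  rw [real_inner_self_eq_norm_sq, h.norm_velocity t s hp, one_pow]

theorem inner_normal_normal (h : IsVortexFilament o a U) (t s : ℝ) (hp : (t, s) ∈ U) :
    inner ℝ (normal (a t) s) (normal (a t) s) = (1 : ℝ) := by
  rw [real_inner_self_eq_norm_sq, h.norm_normal t s hp, one_pow]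

theorem inner_binormal_tangent (o : ∀ x : M, Orientation ℝ (T3 x) (Fin 3)) (a : ℝ → ℝ → M)
    (t s : ℝ) : inner ℝ (binormal o (a t) s) (velSnd a t s) = (0 : ℝ) :=
  inner_cross_left _ _ _

theorem inner_binormal_normal (o : ∀ x : M, Orientation ℝ (T3 x) (Fin 3)) (a : ℝ → ℝ → M)
    (t s : ℝ) : inner ℝ (binormal o (a t) s) (normal (a t) s) = (0 : ℝ) :=
  inner_cross_right _ _ _

variable [IsContMDiffRiemannianBundle 𝓘(ℝ, E3) ∞ E3 (fun x : M => TangentSpace 𝓘(ℝ, E3) x)]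

/-- The norm is smooth away from zero, and `κ` does not vanish. -/
theorem contDiffAt_curvature (h : IsVortexFilament o a U) {p : ℝ × ℝ} (hp : p ∈ U) :
    ContDiffAt ℝ ∞ (fun q : ℝ × ℝ => curvature (a q.1) q.2) p := by
  have h1 := h.smooth_tangent.covSnd h.isOpen
  have h2 := h1.contDiffAt_inner h1 hp
  have hne : (inner ℝ (covSnd a (velSnd a) p.1 p.2) (covSnd a (velSnd a) p.1 p.2) : ℝ) ≠ 0 := by
    rw [real_inner_self_eq_norm_sq]
    exact pow_ne_zero 2 (h.curvature_ne_zero p.1 p.2 hp)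
  refine (h2.sqrt hne).congr_of_eventuallyEq (Filter.Eventually.of_forall fun q => ?_)
  change ‖covSnd a (velSnd a) q.1 q.2‖ = _
  rw [norm_eq_sqrt_real_inner]

theorem smooth_normal (h : IsVortexFilament o a U) :
    SmoothField a U (fun t s => normal (a t) s) :=
  (h.smooth_tangent.covSnd h.isOpen).smul (f := fun t s => (curvature (a t) s)⁻¹)
    fun p hp => (h.contDiffAt_curvature hp).inv (h.curvature_ne_zero p.1 p.2 hp)

/-- The flow itself gives `B = κ⁻¹ ∂_t α`, so smoothness follows without differentiating the volume
form that defines the cross product. -/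
theorem smooth_binormal (h : IsVortexFilament o a U) :
    SmoothField a U (fun t s => binormal o (a t) s) := by
  refine SmoothField.congr h.isOpen ((smoothField_velFst h.isOpen h.contMDiffAt).smul
    (f := fun t s => (curvature (a t) s)⁻¹)
    fun p hp => (h.contDiffAt_curvature hp).inv (h.curvature_ne_zero p.1 p.2 hp)) ?_
  intro t s hp
  rw [h.evolution t s hp, smul_smul, inv_mul_cancel₀ (h.curvature_ne_zero t s hp), one_smul]

theorem contDiffAt_torsion (h : IsVortexFilament o a U) {p : ℝ × ℝ} (hp : p ∈ U) :
    ContDiffAt ℝ ∞ (fun q : ℝ × ℝ => torsion o (a q.1) q.2) p :=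
  (h.smooth_normal.covSnd h.isOpen).contDiffAt_inner h.smooth_binormal hp

/-! #### The Frenet frame -/

/-- Differentiating `⟨T, T⟩ = 1` gives `2κ⟨T, N⟩ = 0`. -/
theorem inner_tangent_normal (h : IsVortexFilament o a U) (t s : ℝ) (hp : (t, s) ∈ U) :
    inner ℝ (velSnd a t s) (normal (a t) s) = (0 : ℝ) := by
  have h1 := h.smooth_tangent.inner_covSnd_of_const h.isOpen h.smooth_tangent
    h.inner_tangent_tangent hp
  rw [h.covSnd_tangent t s hp, inner_smul_left, inner_smul_right,
    real_inner_comm (velSnd a t s)] at h1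
  have h2 := h.curvature_ne_zero t s hp
  simp only [conj_trivial] at h1
  have h3 : curvature (a t) s * inner ℝ (velSnd a t s) (normal (a t) s) = 0 := by linarith
  exact (mul_eq_zero.1 h3).resolve_left h2

theorem norm_binormal (h : IsVortexFilament o a U) (t s : ℝ) (hp : (t, s) ∈ U) :
    ‖binormal o (a t) s‖ = 1 :=
  norm_cross _ (h.norm_velocity t s hp) (h.norm_normal t s hp) (h.inner_tangent_normal t s hp)

theorem inner_binormal_binormal (h : IsVortexFilament o a U) (t s : ℝ) (hp : (t, s) ∈ U) :
    inner ℝ (binormal o (a t) s) (binormal o (a t) s) = (1 : ℝ) := by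
  rw [real_inner_self_eq_norm_sq, h.norm_binormal t s hp, one_pow]

theorem eq_frame (h : IsVortexFilament o a U) (hp : (t, s) ∈ U) (v : T3 (a t s)) :
    v = (inner ℝ v (velSnd a t s) : ℝ) • velSnd a t s
      + (inner ℝ v (normal (a t) s) : ℝ) • normal (a t) s
      + (inner ℝ v (binormal o (a t) s) : ℝ) • binormal o (a t) s :=
  eq_of_inner_frame (h.norm_velocity t s hp) (h.norm_normal t s hp) (h.norm_binormal t s hp)
    (h.inner_tangent_normal t s hp) (inner_binormal_tangent o a t s)
    (inner_binormal_normal o a t s) v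

theorem covSnd_normal (h : IsVortexFilament o a U) (t s : ℝ) (hp : (t, s) ∈ U) :
    covSnd a (fun t s => normal (a t) s) t s =
      -curvature (a t) s • velSnd a t s + torsion o (a t) s • binormal o (a t) s := by
  have h1 := h.smooth_tangent.inner_covSnd_of_const h.isOpen h.smooth_normal
    h.inner_tangent_normal hp
  have h2 := h.smooth_normal.inner_covSnd_of_const h.isOpen h.smooth_normal
    h.inner_normal_normal hp
  rw [h.covSnd_tangent t s hp, inner_smul_left, h.inner_normal_normal t s hp,
    real_inner_comm (covSnd a (fun t s => normal (a t) s) t s)] at h1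
  rw [real_inner_comm (covSnd a (fun t s => normal (a t) s) t s)] at h2
  simp only [conj_trivial] at h1
  have h3 : inner ℝ (covSnd a (fun t s => normal (a t) s) t s) (velSnd a t s)
      = -curvature (a t) s := by linarith
  have h4 : inner ℝ (covSnd a (fun t s => normal (a t) s) t s) (normal (a t) s) = (0 : ℝ) := by
    linarith
  rw [h.eq_frame hp (covSnd a (fun t s => normal (a t) s) t s), h3, h4, zero_smul, add_zero]
  rfl

theorem covSnd_binormal (h : IsVortexFilament o a U) (t s : ℝ) (hp : (t, s) ∈ U) :
    covSnd a (fun t s => binormal o (a t) s) t s = -torsion o (a t) s • normal (a t) s := by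
  have h1 := h.smooth_binormal.inner_covSnd_of_const h.isOpen h.smooth_tangent
    (fun t s _ => inner_binormal_tangent o a t s) hp
  have h2 := h.smooth_binormal.inner_covSnd_of_const h.isOpen h.smooth_normal
    (fun t s _ => inner_binormal_normal o a t s) hp
  have h3 := h.smooth_binormal.inner_covSnd_of_const h.isOpen h.smooth_binormal
    h.inner_binormal_binormal hp
  rw [h.covSnd_tangent t s hp, inner_smul_right, inner_binormal_normal, mul_zero, add_zero] at h1
  rw [h.covSnd_normal t s hp, inner_add_right, inner_smul_right, inner_smul_right,
    inner_binormal_tangent, h.inner_binormal_binormal t s hp] at h2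
  rw [real_inner_comm (covSnd a (fun t s => binormal o (a t) s) t s)] at h3
  have h4 : inner ℝ (covSnd a (fun t s => binormal o (a t) s) t s) (normal (a t) s)
      = -torsion o (a t) s := by linarith
  have h5 : inner ℝ (covSnd a (fun t s => binormal o (a t) s) t s) (binormal o (a t) s)
      = (0 : ℝ) := by linarith
  rw [h.eq_frame hp (covSnd a (fun t s => binormal o (a t) s) t s), h1, h4, h5, zero_smul,
    zero_smul, zero_add, add_zero]

/-! #### Derivatives of curvature and torsion along the slices -/

theorem differentiableAt_curvature (h : IsVortexFilament o a U) (hp : (t, s) ∈ U) :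
    DifferentiableAt ℝ (curvature (a t)) s :=
  (hasDerivAt_partial_snd ((h.contDiffAt_curvature hp).differentiableAt
    (by simp))).differentiableAt

theorem differentiableAt_deriv_curvature (h : IsVortexFilament o a U) (hp : (t, s) ∈ U) :
    DifferentiableAt ℝ (deriv (curvature (a t))) s :=
  (hasDerivAt_partial_snd ((contDiffAt_partial_snd (h.contDiffAt_curvature hp)).differentiableAt
    (by simp))).differentiableAt

theorem differentiableAt_torsion (h : IsVortexFilament o a U) (hp : (t, s) ∈ U) :
    DifferentiableAt ℝ (torsion o (a t)) s :=
  (hasDerivAt_partial_snd ((h.contDiffAt_torsion hp).differentiableAt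
    (by simp))).differentiableAt

theorem differentiableAt_curvature_fst (h : IsVortexFilament o a U) (hp : (t, s) ∈ U) :
    DifferentiableAt ℝ (fun t' => curvature (a t') s) t :=
  (hasDerivAt_partial_fst ((h.contDiffAt_curvature hp).differentiableAt
    (by simp))).differentiableAt

/-! #### The evolution equations -/

/-- `D_t T = D_s ∂_t α = D_s (κB)`, by torsion-freeness and the filament equation; then the Frenet
equation for `B`. -/
theorem covFst_tangent (h : IsVortexFilament o a U) (t s : ℝ) (hp : (t, s) ∈ U) :
    covFst a (velSnd a) t s = deriv (curvature (a t)) s • binormal o (a t) s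
      + (-(curvature (a t) s * torsion o (a t) s)) • normal (a t) s := by
  rw [← covSnd_velFst h.isOpen h.contMDiffAt hp, covSnd_congr h.isOpen h.evolution hp]
  have h1 := covDeriv_smul (h.smooth_binormal.diffAlong_snd hp) (h.differentiableAt_curvature hp)
  have h2 : covSnd a (fun t s => curvature (a t) s • binormal o (a t) s) t s = _ := h1
  have h3 : covDeriv (a t) (fun s => binormal o (a t) s) s = _ := h.covSnd_binormal t s hp
  rw [h2, h3, smul_smul, mul_neg]

theorem covSnd_covFst_tangent (h : IsVortexFilament o a U) (t s : ℝ) (hp : (t, s) ∈ U) :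
    covSnd a (covFst a (velSnd a)) t s =
      deriv (deriv (curvature (a t))) s • binormal o (a t) s
      + deriv (curvature (a t)) s • -torsion o (a t) s • normal (a t) s
      + (-(deriv (curvature (a t)) s * torsion o (a t) s
          + curvature (a t) s * deriv (torsion o (a t)) s) • normal (a t) s
      + (-(curvature (a t) s * torsion o (a t) s)) • (-curvature (a t) s • velSnd a t s
        + torsion o (a t) s • binormal o (a t) s)) := by
  rw [covSnd_congr h.isOpen h.covFst_tangent hp]
  have hB := h.smooth_binormal.diffAlong_snd hp
  have hN := h.smooth_normal.diffAlong_snd hp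
  have hd1 := h.differentiableAt_deriv_curvature hp
  have hd2 := ((h.differentiableAt_curvature hp).hasDerivAt.fun_mul
    (h.differentiableAt_torsion hp).hasDerivAt).fun_neg
  have h1 := covDeriv_add (hB.smul hd1) (hN.smul hd2.differentiableAt)
  rw [covDeriv_smul hB hd1, covDeriv_smul hN hd2.differentiableAt, hd2.deriv] at h1
  have h2 : covDeriv (a t) (fun s => binormal o (a t) s) s = _ := h.covSnd_binormal t s hp
  have h3 : covDeriv (a t) (fun s => normal (a t) s) s = _ := h.covSnd_normal t s hp
  rw [h2, h3] at h1
  exact h1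

theorem covFst_covSnd_tangent (h : IsVortexFilament o a U) (t s : ℝ) (hp : (t, s) ∈ U) :
    covFst a (covSnd a (velSnd a)) t s =
      deriv (fun t' => curvature (a t') s) t • normal (a t) s
      + curvature (a t) s • covFst a (fun t s => normal (a t) s) t s := by
  rw [covFst_congr h.isOpen h.covSnd_tangent hp]
  exact covDeriv_smul (h.smooth_normal.diffAlong_fst hp) (h.differentiableAt_curvature_fst hp)

theorem commutator (h : IsVortexFilament o a U) {V : ∀ t s, T3 (a t s)} (hV : SmoothField a U V)
    (hp : (t, s) ∈ U) : covFst a (covSnd a V) t s = covSnd a (covFst a V) t s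
      + curvature (a t) s • riemann (velSnd a t s) (binormal o (a t) s) (V t s) := by
  rw [← riemann_smul_middle, ← h.evolution t s hp, ← hV.covFst_covSnd_sub h.isOpen hp]
  abel

theorem inner_covFst_normal_normal (h : IsVortexFilament o a U) (hp : (t, s) ∈ U) :
    inner ℝ (covFst a (fun t s => normal (a t) s) t s) (normal (a t) s) = (0 : ℝ) := by
  have h1 := h.smooth_normal.inner_covFst_of_const h.isOpen h.smooth_normal
    h.inner_normal_normal hp
  rw [real_inner_comm (covFst a (fun t s => normal (a t) s) t s)] at h1
  linarith

/-- The `N`-component of the commutator identity for `T`; `D_t N` contributes nothing, being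
orthogonal to `N`. -/
theorem deriv_curvature (h : IsVortexFilament o a U) (hp : (t, s) ∈ U) :
    deriv (fun t' => curvature (a t') s) t =
      -2 * torsion o (a t) s * deriv (curvature (a t)) s
        - curvature (a t) s * deriv (torsion o (a t)) s
        + curvature (a t) s * curv (velSnd a t s) (binormal o (a t) s) (velSnd a t s)
          (normal (a t) s) := by
  have h1 := congrArg (fun v => inner ℝ v (normal (a t) s)) (h.commutator h.smooth_tangent hp)
  simp only [h.covFst_covSnd_tangent t s hp, h.covSnd_covFst_tangent t s hp, inner_add_left,
    inner_smul_left, conj_trivial, h.inner_normal_normal t s hp, h.inner_tangent_normal t s hp,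
    inner_binormal_normal, h.inner_covFst_normal_normal hp] at h1
  rw [curv]
  linarith

/-- The `B`-component of the same identity, divided by `κ`. It identifies the bracket in the torsion
equation, up to `κ²/2`, as the rotation speed of `N` towards `B`. -/
theorem inner_covFst_normal_binormal (h : IsVortexFilament o a U) (t s : ℝ) (hp : (t, s) ∈ U) :
    inner ℝ (covFst a (fun t s => normal (a t) s) t s) (binormal o (a t) s) =
      1 / curvature (a t) s * deriv (deriv (curvature (a t))) s - torsion o (a t) s ^ 2
        + curv (velSnd a t s) (binormal o (a t) s) (velSnd a t s) (binormal o (a t) s) := by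
  have h1 := congrArg (fun v => inner ℝ v (binormal o (a t) s)) (h.commutator h.smooth_tangent hp)
  have hTB : inner ℝ (velSnd a t s) (binormal o (a t) s) = (0 : ℝ) := by
    rw [real_inner_comm, inner_binormal_tangent]
  have hNB : inner ℝ (normal (a t) s) (binormal o (a t) s) = (0 : ℝ) := by
    rw [real_inner_comm, inner_binormal_normal]
  simp only [h.covFst_covSnd_tangent t s hp, h.covSnd_covFst_tangent t s hp, inner_add_left,
    inner_smul_left, conj_trivial, hTB, hNB, h.inner_binormal_binormal t s hp] at h1
  have hk := h.curvature_ne_zero t s hp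
  rw [curv]
  field_simp
  linarith

theorem potential_add_curv_eventuallyEq (h : IsVortexFilament o a U) (hp : (t, s) ∈ U) :
    (fun r => potential (curvature (a t)) (torsion o (a t)) r
      + curv (velSnd a t r) (binormal o (a t) r) (velSnd a t r) (binormal o (a t) r)) =ᶠ[𝓝 s]
    fun r => inner ℝ (covFst a (fun t s => normal (a t) s) t r) (binormal o (a t) r)
      + 1 / 2 * curvature (a t) r ^ 2 := by
  filter_upwards [eventually_mem_snd h.isOpen hp] with r hr
  rw [h.inner_covFst_normal_binormal t r hr, potential]
  ring

/-- The curvature term is never differentiated on its own: near `s` the bracket equals the smooth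
function `⟨D_t N, B⟩ + κ²/2`. The term `⟨D_t N, D_s B⟩ = -τ⟨D_t N, N⟩` vanishes. -/
theorem hasDerivAt_potential_add_curv (h : IsVortexFilament o a U) (hp : (t, s) ∈ U) :
    HasDerivAt (fun r => potential (curvature (a t)) (torsion o (a t)) r
      + curv (velSnd a t r) (binormal o (a t) r) (velSnd a t r) (binormal o (a t) r))
      (inner ℝ (covSnd a (covFst a (fun t s => normal (a t) s)) t s) (binormal o (a t) s)
        + curvature (a t) s * deriv (curvature (a t)) s) s := by
  have h1 := ((h.smooth_normal.covFst h.isOpen).hasDerivAt_inner_snd h.smooth_binormal hp).add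
    (((h.differentiableAt_curvature hp).hasDerivAt.pow 2).const_mul (1 / 2))
  refine (h1.congr_of_eventuallyEq (h.potential_add_curv_eventuallyEq hp)).congr_deriv ?_
  rw [h.covSnd_binormal t s hp, inner_smul_right, h.inner_covFst_normal_normal hp]
  simp; ring

/-- Differentiate `τ = ⟨D_s N, B⟩`. The commutator turns `⟨D_t D_s N, B⟩` into `⟨D_s D_t N, B⟩ +
κ(T,B,N,B)`, and `⟨D_s N, D_t B⟩ = -κ⟨T, D_t B⟩ = κ⟨D_t T, B⟩ = κκ'` is the derivative of `κ²/2`. -/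
theorem hasDerivAt_torsion (h : IsVortexFilament o a U) (hp : (t, s) ∈ U) :
    HasDerivAt (fun t' => torsion o (a t') s)
      (deriv (fun r => potential (curvature (a t)) (torsion o (a t)) r
        + curv (velSnd a t r) (binormal o (a t) r) (velSnd a t r) (binormal o (a t) r)) s
        - curvature (a t) s * curv (binormal o (a t) s) (velSnd a t s) (normal (a t) s)
          (binormal o (a t) s)) t := by
  have h1 := (h.smooth_normal.covSnd h.isOpen).hasDerivAt_inner_fst h.smooth_binormal hp
  refine HasDerivAt.congr_deriv h1 ?_
  have h2 := h.smooth_binormal.inner_covFst_of_const h.isOpen h.smooth_tangent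
    (fun t s _ => inner_binormal_tangent o a t s) hp
  have h3 := h.smooth_binormal.inner_covFst_of_const h.isOpen h.smooth_binormal
    h.inner_binormal_binormal hp
  rw [h.covFst_tangent t s hp, inner_add_right, inner_smul_right, inner_smul_right,
    h.inner_binormal_binormal t s hp, inner_binormal_normal] at h2
  rw [real_inner_comm _ (binormal o (a t) s)] at h3
  rw [(h.hasDerivAt_potential_add_curv hp).deriv, h.commutator h.smooth_normal hp,
    h.covSnd_normal t s hp]
  simp only [inner_add_left, inner_smul_left, conj_trivial]
  rw [real_inner_comm _ (velSnd a t s), real_inner_comm _ (binormal o (a t) s)]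
  rw [curv, riemann_antisymm (binormal o (a t) s), inner_neg_left]
  have h4 : inner ℝ (covFst a (fun t s => binormal o (a t) s) t s) (binormal o (a t) s)
    = (0 : ℝ) := by linarith
  rw [h4]
  linear_combination (-curvature (a t) s) * h2

end IsVortexFilament

end

end Filament

end

noncomputable section

namespace Filament

/-! ### Hasimoto's transformation -/

theorem contDiff_of_contDiffAt_slice {f : ℝ × ℝ → ℝ} {t : ℝ}
    (h : ∀ s, ContDiffAt ℝ ∞ f (t, s)) : ContDiff ℝ ∞ fun s => f (t, s) :=
  contDiff_iff_contDiffAt.2 fun s => ContDiffAt.comp (f := fun r : ℝ => (t, r)) s (h s)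
    (contDiffAt_const.prodMk contDiffAt_id)

/-- Differentiation under the integral sign. -/
theorem hasDerivAt_integral_slice {f : ℝ × ℝ → ℝ} {I : Set ℝ} (hI : IsOpen I)
    (hf : ∀ p ∈ I ×ˢ (univ : Set ℝ), ContDiffAt ℝ ∞ f p) {t : ℝ} (ht : t ∈ I) (b c : ℝ) :
    HasDerivAt (fun t' => ∫ x in b..c, f (t', x)) (∫ x in b..c, deriv (fun t' => f (t', x)) t) t := by
  obtain ⟨δ, hδ, hball⟩ := Metric.nhds_basis_closedBall.mem_iff.1 (hI.mem_nhds ht)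
  have hcont {t : ℝ} (ht : t ∈ I) : Continuous fun x => f (t, x) :=
    (contDiff_of_contDiffAt_slice fun s => hf (t, s) ⟨ht, mem_univ s⟩).continuous
  have hd : ∀ p ∈ I ×ˢ (univ : Set ℝ),
      ContDiffAt ℝ ∞ (fun q : ℝ × ℝ => deriv (fun t' => f (t', q.2)) q.1) p :=
    fun p hp => contDiffAt_partial_fst (hf p hp)
  have hdcont : Continuous fun x => deriv (fun t' => f (t', x)) t :=
    (contDiff_of_contDiffAt_slice fun s => hd (t, s) ⟨ht, mem_univ s⟩).continuous
  have hK : IsCompact (Metric.closedBall t δ ×ˢ uIcc b c) :=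
    (isCompact_closedBall t δ).prod isCompact_uIcc
  -- Compactness of the closed time interval times the range of integration provides a constant
  -- dominating function.
  obtain ⟨C, hC⟩ := hK.exists_bound_of_continuousOn
    (f := fun q : ℝ × ℝ => deriv (fun t' => f (t', q.2)) q.1) fun p hp =>
      (hd p ⟨hball hp.1, mem_univ _⟩).continuousAt.continuousWithinAt
  refine (intervalIntegral.hasDerivAt_integral_of_dominated_loc_of_deriv_le
    (F := fun t' x => f (t', x)) (F' := fun t' x => deriv (fun t' => f (t', x)) t')
    (s := Metric.closedBall t δ) (bound := fun _ => C) (Metric.closedBall_mem_nhds t hδ)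
    ?_ ?_ ?_ ?_ ?_ ?_).2
  · filter_upwards [hI.mem_nhds ht] with r hr using (hcont hr).aestronglyMeasurable
  · exact (hcont ht).intervalIntegrable _ _
  · exact hdcont.aestronglyMeasurable
  · exact Filter.Eventually.of_forall fun x hx r hr => hC (r, x) ⟨hr, uIoc_subset_uIcc hx⟩
  · exact intervalIntegrable_const
  · exact Filter.Eventually.of_forall fun x _ r hr => (hasDerivAt_partial_fst
      ((hf (r, x) ⟨hball hr, mem_univ x⟩).differentiableAt
        (by simp))).differentiableAt.hasDerivAt

theorem contDiffAt_potential {κ τ : ℝ → ℝ → ℝ} {p : ℝ × ℝ}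
    (hκ : ContDiffAt ℝ ∞ (fun q : ℝ × ℝ => κ q.1 q.2) p)
    (hτ : ContDiffAt ℝ ∞ (fun q : ℝ × ℝ => τ q.1 q.2) p) (hne : κ p.1 p.2 ≠ 0) :
    ContDiffAt ℝ ∞ (fun q : ℝ × ℝ => potential (κ q.1) (τ q.1) q.2) p :=
  (((contDiffAt_const.div hκ hne).mul (contDiffAt_partial_snd (contDiffAt_partial_snd hκ))).sub
    (hτ.pow 2)).add (contDiffAt_const.mul (hκ.pow 2))

/-! ### Hasimoto's function in the arclength variable. -/

section Space

variable {κ τ : ℝ → ℝ}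

theorem hasDerivAt_exp_integral (hτ : Continuous τ) (s : ℝ) :
    HasDerivAt (fun s => Complex.exp (Complex.I * ((∫ x in (0 : ℝ)..s, τ x : ℝ) : ℂ)))
      (Complex.I * τ s * Complex.exp (Complex.I * ((∫ x in (0 : ℝ)..s, τ x : ℝ) : ℂ))) s := by
  have h1 := (hτ.integral_hasStrictDerivAt 0 s).hasDerivAt.ofReal_comp
  exact ((h1.const_mul Complex.I).cexp).congr_deriv (by ring)

theorem contDiff_hasimoto (hκ : ContDiff ℝ ∞ κ) (hτ : ContDiff ℝ ∞ τ) :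
    ContDiff ℝ ∞ (hasimoto κ τ) := by
  have h1 : ContDiff ℝ ∞ fun s => ∫ x in (0 : ℝ)..s, τ x := by
    rw [contDiff_infty_iff_deriv]
    have hd := fun s => (hτ.continuous.integral_hasStrictDerivAt 0 s).hasDerivAt
    refine ⟨fun s => (hd s).differentiableAt, ?_⟩
    rw [show deriv (fun s => ∫ x in (0 : ℝ)..s, τ x) = τ from funext fun s => (hd s).deriv]
    exact hτ
  have h2 {f : ℝ → ℝ} (hf : ContDiff ℝ ∞ f) : ContDiff ℝ ∞ fun s => (f s : ℂ) :=
    Complex.ofRealCLM.contDiff.comp hf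
  exact (h2 hκ).mul (contDiff_const.mul (h2 h1)).cexp

theorem deriv_deriv_hasimoto (hκ : ContDiff ℝ ∞ κ) (hτ : ContDiff ℝ ∞ τ) (s : ℝ) :
    deriv (deriv (hasimoto κ τ)) s =
      (deriv (deriv κ) s + Complex.I * (2 * τ s * deriv κ s + κ s * deriv τ s) - κ s * τ s ^ 2) *
        Complex.exp (Complex.I * ((∫ x in (0 : ℝ)..s, τ x : ℝ) : ℂ)) := by
  have hκ' : ContDiff ℝ ∞ (deriv κ) := (contDiff_infty_iff_deriv.1 hκ).2
  have hd {f : ℝ → ℝ} (hf : ContDiff ℝ ∞ f) (s : ℝ) :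
      HasDerivAt (fun s => (f s : ℂ)) (deriv f s : ℝ) s :=
    ((hf.differentiable (by simp)) s).hasDerivAt.ofReal_comp
  have hE := hasDerivAt_exp_integral hτ.continuous
  have h1 : deriv (hasimoto κ τ) = fun s => (((deriv κ s : ℝ) : ℂ) + Complex.I * (κ s * τ s)) *
      Complex.exp (Complex.I * ((∫ x in (0 : ℝ)..s, τ x : ℝ) : ℂ)) := by
    funext s
    have := ((hd hκ s).mul (hE s)).deriv
    refine Eq.trans this ?_
    ring
  rw [h1]
  have h2 := (((hd hκ' s).fun_add
    (((hd hκ s).fun_mul (hd hτ s)).const_mul Complex.I)).fun_mul (hE s)).deriv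
  refine Eq.trans h2 ?_
  linear_combination (κ s * τ s ^ 2 *
    Complex.exp (Complex.I * ((∫ x in (0 : ℝ)..s, τ x : ℝ) : ℂ))) * Complex.I_sq

theorem norm_hasimoto (s : ℝ) : ‖hasimoto κ τ s‖ = |κ s| := by
  rw [hasimoto, norm_mul, mul_comm Complex.I, Complex.norm_exp_ofReal_mul_I, mul_one,
    Complex.norm_real, Real.norm_eq_abs]

end Space

/-! ### Time evolution of Hasimoto's function and the gauge rotation. -/

section Time

variable {κ τ : ℝ → ℝ → ℝ} {I : Set ℝ} {t : ℝ}

/-- The time derivative of Hasimoto's function in a space of constant curvature. -/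
theorem hasDerivAt_hasimoto (hI : IsOpen I)
    (hκ : ∀ p ∈ I ×ˢ (univ : Set ℝ), ContDiffAt ℝ ∞ (fun q : ℝ × ℝ => κ q.1 q.2) p)
    (hτ : ∀ p ∈ I ×ˢ (univ : Set ℝ), ContDiffAt ℝ ∞ (fun q : ℝ × ℝ => τ q.1 q.2) p)
    (hne : ∀ t ∈ I, ∀ s, κ t s ≠ 0)
    (hκt : ∀ t ∈ I, ∀ s, deriv (fun t' => κ t' s) t =
      -2 * τ t s * deriv (κ t) s - κ t s * deriv (τ t) s)
    (hτt : ∀ t ∈ I, ∀ s, deriv (fun t' => τ t' s) t = deriv (potential (κ t) (τ t)) s)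
    (ht : t ∈ I) (s : ℝ) :
    HasDerivAt (fun t' => hasimoto (κ t') (τ t') s)
      (Complex.I * (deriv (deriv (hasimoto (κ t) (τ t))) s
        + 1 / 2 * (‖hasimoto (κ t) (τ t) s‖ : ℂ) ^ 2 * hasimoto (κ t) (τ t) s
        - hasimoto (κ t) (τ t) s * potential (κ t) (τ t) 0)) t := by
  have hmem (s : ℝ) : (t, s) ∈ I ×ˢ (univ : Set ℝ) := ⟨ht, mem_univ s⟩
  have hP : ContDiff ℝ ∞ (potential (κ t) (τ t)) :=
    contDiff_of_contDiffAt_slice (f := fun q : ℝ × ℝ => potential (κ q.1) (τ q.1) q.2)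
      fun s => contDiffAt_potential (hκ _ (hmem s)) (hτ _ (hmem s)) (hne t ht s)
  have h1 := hasDerivAt_integral_slice hI hτ ht 0 s
  -- The torsion equation is an exact `s`-derivative; the lower endpoint of the phase integral is
  -- the origin of the term `A(t)`.
  have h2 : ∫ x in (0 : ℝ)..s, deriv (fun t' => τ t' x) t =
      potential (κ t) (τ t) s - potential (κ t) (τ t) 0 := by
    simp only [hτt t ht]
    exact intervalIntegral.integral_deriv_eq_sub (fun x _ => hP.differentiable (by simp) x)
      ((contDiff_infty_iff_deriv.1 hP).2.continuous.intervalIntegrable _ _)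
  dsimp only at h1
  rw [h2] at h1
  have h3 : HasDerivAt (fun t' => κ t' s)
      (-2 * τ t s * deriv (κ t) s - κ t s * deriv (τ t) s) t := by
    rw [← hκt t ht s]
    exact (hasDerivAt_partial_fst ((hκ _ (hmem s)).differentiableAt
      (by simp))).differentiableAt.hasDerivAt
  have h4 := h3.ofReal_comp.mul ((h1.ofReal_comp.const_mul Complex.I).cexp)
  refine HasDerivAt.congr_deriv h4 ?_
  have hκs : ContDiff ℝ ∞ (κ t) :=
    contDiff_of_contDiffAt_slice (f := fun q : ℝ × ℝ => κ q.1 q.2) fun s => hκ _ (hmem s)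
  have hτs : ContDiff ℝ ∞ (τ t) :=
    contDiff_of_contDiffAt_slice (f := fun q : ℝ × ℝ => τ q.1 q.2) fun s => hτ _ (hmem s)
  have habs : ((|κ t s| : ℝ) : ℂ) ^ 2 = (κ t s : ℂ) ^ 2 := by
    rw [← Complex.ofReal_pow, sq_abs, Complex.ofReal_pow]
  rw [deriv_deriv_hasimoto hκs hτs, norm_hasimoto, habs, hasimoto]
  generalize Complex.exp (Complex.I * ((∫ x in (0 : ℝ)..s, τ t x : ℝ) : ℂ)) = E
  have h5 : (κ t s : ℂ) ≠ 0 := Complex.ofReal_ne_zero.2 (hne t ht s)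
  generalize potential (κ t) (τ t) 0 = P₀
  simp only [potential]
  push_cast
  field_simp
  -- With `I² = -1`, the imaginary part `2τκ' + κτ'` of the factor in `ψ''` becomes the real factor
  -- in `ψ_t`, that is `κ_t`.
  linear_combination (-2 * E * (2 * τ t s * ((deriv (κ t) s : ℝ) : ℂ)
    + κ t s * ((deriv (τ t) s : ℝ) : ℂ))) * Complex.I_sq

theorem hasDerivAt_gaugeRotate {A : ℝ → ℝ} {ψ : ℝ → ℝ → ℂ} {ε s : ℝ} {ψ' : ℂ}
    (hA : ContinuousOn A (Ioo (-ε) ε)) (ht : t ∈ Ioo (-ε) ε)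
    (hψ : HasDerivAt (fun t' => ψ t' s) ψ' t) :
    HasDerivAt (fun t' => gaugeRotate A ψ t' s)
      (Complex.exp (Complex.I * ((∫ x in (0 : ℝ)..t, A x : ℝ) : ℂ)) *
        (Complex.I * A t * ψ t s + ψ')) t := by
  have h0 : (0 : ℝ) ∈ Ioo (-ε) ε := by
    constructor <;> linarith [ht.1, ht.2]
  -- `A` is only known to be continuous on the time interval, so the segment from `0` to `t` must
  -- stay inside it.
  have hsub : uIcc 0 t ⊆ Ioo (-ε) ε := (ordConnected_Ioo).uIcc_subset h0 ht
  have h1 : HasDerivAt (fun t' => ∫ x in (0 : ℝ)..t', A x) (A t) t :=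
    intervalIntegral.integral_hasDerivAt_right (hA.mono hsub).intervalIntegrable
      (hA.stronglyMeasurableAtFilter isOpen_Ioo t ht) (hA.continuousAt (isOpen_Ioo.mem_nhds ht))
  exact (((h1.ofReal_comp.const_mul Complex.I).cexp).mul hψ).congr_deriv (by ring)

theorem deriv_deriv_gaugeRotate (A : ℝ → ℝ) (ψ : ℝ → ℝ → ℂ) (t s : ℝ) :
    deriv (deriv (gaugeRotate A ψ t)) s =
      Complex.exp (Complex.I * ((∫ x in (0 : ℝ)..t, A x : ℝ) : ℂ)) * deriv (deriv (ψ t)) s := by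
  have h1 : deriv (gaugeRotate A ψ t) = fun s =>
      Complex.exp (Complex.I * ((∫ x in (0 : ℝ)..t, A x : ℝ) : ℂ)) * deriv (ψ t) s :=
    funext fun s => deriv_const_mul_field _
  rw [h1, deriv_const_mul_field]

theorem norm_gaugeRotate (A : ℝ → ℝ) (ψ : ℝ → ℝ → ℂ) (t s : ℝ) :
    ‖gaugeRotate A ψ t s‖ = ‖ψ t s‖ := by
  rw [gaugeRotate, norm_mul, mul_comm Complex.I, Complex.norm_exp_ofReal_mul_I, one_mul]

end Time

end Filament

end

/-! ### The evolution equations and the Schrödinger equation for the filament. -/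

theorem mainTheorem1 {M : Type*} [TopologicalSpace M] [ChartedSpace E3 M]
    [IsManifold 𝓘(ℝ, E3) ∞ M]
    [RiemannianBundle (fun x : M => TangentSpace 𝓘(ℝ, E3) x)]
    [IsContMDiffRiemannianBundle 𝓘(ℝ, E3) ∞ E3 (fun x : M => TangentSpace 𝓘(ℝ, E3) x)]
    (o : ∀ x : M, Orientation ℝ (T3 x) (Fin 3)) (ho : IsManifoldOrientation o)
    (L ε : ℝ) (hL : 0 < L) (hε : 0 < ε)
    (α : ℝ → AddCircle L → M)
    (hsmooth : ContMDiffOn 𝓘(ℝ, ℝ × ℝ) 𝓘(ℝ, E3) ∞ (fun p : ℝ × ℝ => lift α p.1 p.2)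
      (Ioo (-ε) ε ×ˢ univ))
    (hunit : ∀ t ∈ Ioo (-ε) ε, ∀ s : ℝ, ‖velocity (lift α t) s‖ = 1)
    (hcurv : ∀ t ∈ Ioo (-ε) ε, ∀ s : ℝ, curvature (lift α t) s ≠ 0)
    (hvfe : ∀ t ∈ Ioo (-ε) ε, ∀ s : ℝ,
      (velocity (fun t' => lift α t' s) t : T3 (lift α t s)) =
        curvature (lift α t) s • binormal o (lift α t) s)
    (κ τ : ℝ → ℝ → ℝ)
    (hκ : ∀ t s, κ t s = curvature (lift α t) s)
    (hτ : ∀ t s, τ t s = torsion o (lift α t) s)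
    (T N B : ∀ t s : ℝ, T3 (lift α t s))
    (hT : ∀ t s, T t s = velocity (lift α t) s)
    (hN : ∀ t s, N t s = normal (lift α t) s)
    (hB : ∀ t s, B t s = binormal o (lift α t) s)
    (A : ℝ → ℝ) (hA : ∀ t, A t = potential (κ t) (τ t) 0)
    (ψ Ψ : ℝ → ℝ → ℂ)
    (hψ : ∀ t s, ψ t s = hasimoto (κ t) (τ t) s)
    (hΨ : ∀ t s, Ψ t s = gaugeRotate A ψ t s) :
    (ContDiffOn ℝ ∞ (fun p : ℝ × ℝ => κ p.1 p.2) (Ioo (-ε) ε ×ˢ univ) ∧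
      ContDiffOn ℝ ∞ (fun p : ℝ × ℝ => τ p.1 p.2) (Ioo (-ε) ε ×ˢ univ) ∧
      ∀ t ∈ Ioo (-ε) ε, ∀ s : ℝ,
        deriv (fun t' => κ t' s) t =
          -2 * τ t s * deriv (κ t) s - κ t s * deriv (τ t) s
            + κ t s * curv (T t s) (B t s) (T t s) (N t s) ∧
        DifferentiableAt ℝ (fun r => potential (κ t) (τ t) r
            + curv (T t r) (B t r) (T t r) (B t r)) s ∧
        deriv (fun t' => τ t' s) t =
          deriv (fun r => potential (κ t) (τ t) r
              + curv (T t r) (B t r) (T t r) (B t r)) s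
            - κ t s * curv (B t s) (T t s) (N t s) (B t s)) ∧
    ∀ K₀ : ℝ, HasConstantCurvature M K₀ →
      (∀ t ∈ Ioo (-ε) ε, ∀ s : ℝ,
        curv (T t s) (B t s) (T t s) (B t s) = K₀ ∧
        curv (B t s) (T t s) (N t s) (B t s) = 0 ∧
        curv (T t s) (B t s) (T t s) (N t s) = 0) ∧
      ContinuousOn A (Ioo (-ε) ε) ∧
      ∀ t ∈ Ioo (-ε) ε, ContDiff ℝ ∞ (ψ t) ∧ ContDiff ℝ ∞ (Ψ t) ∧ ∀ s : ℝ,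
        DifferentiableAt ℝ (fun t' => ψ t' s) t ∧
        -Complex.I * deriv (fun t' => ψ t' s) t =
          deriv (deriv (ψ t)) s + 1 / 2 * (‖ψ t s‖ : ℂ) ^ 2 * ψ t s - ψ t s * A t ∧
        DifferentiableAt ℝ (fun t' => Ψ t' s) t ∧
        -Complex.I * deriv (fun t' => Ψ t' s) t =
          deriv (deriv (Ψ t)) s + 1 / 2 * (‖Ψ t s‖ : ℂ) ^ 2 * Ψ t s := by
  obtain rfl : κ = fun t s => curvature (lift α t) s := funext₂ hκ
  obtain rfl : τ = fun t s => torsion o (lift α t) s := funext₂ hτ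
  obtain rfl : T = fun t s => velocity (lift α t) s := funext₂ hT
  obtain rfl : N = fun t s => normal (lift α t) s := funext₂ hN
  obtain rfl : B = fun t s => binormal o (lift α t) s := funext₂ hB
  obtain rfl : A = fun t => potential (curvature (lift α t)) (torsion o (lift α t)) 0 := funext hA
  obtain rfl : ψ = fun t s => hasimoto (curvature (lift α t)) (torsion o (lift α t)) s :=
    funext₂ hψ
  have hU : IsOpen (Ioo (-ε) ε ×ˢ (univ : Set ℝ)) := isOpen_Ioo.prod isOpen_univ
  have h : IsVortexFilament o (lift α) (Ioo (-ε) ε ×ˢ univ) :=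
    { isOpen := hU
      contMDiffAt := fun p hp => hsmooth.contMDiffAt (hU.mem_nhds hp)
      norm_velocity := fun t s hp => hunit t hp.1 s
      curvature_ne_zero := fun t s hp => hcurv t hp.1 s
      evolution := fun t s hp => hvfe t hp.1 s }
  have hmem {t : ℝ} (ht : t ∈ Ioo (-ε) ε) (s : ℝ) : (t, s) ∈ Ioo (-ε) ε ×ˢ (univ : Set ℝ) :=
    ⟨ht, mem_univ s⟩
  refine ⟨⟨fun p hp => (h.contDiffAt_curvature hp).contDiffWithinAt,
    fun p hp => (h.contDiffAt_torsion hp).contDiffWithinAt, fun t ht s =>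
      ⟨h.deriv_curvature (hmem ht s), (h.hasDerivAt_potential_add_curv (hmem ht s)).differentiableAt,
        (h.hasDerivAt_torsion (hmem ht s)).deriv⟩⟩, fun K₀ hK => ?_⟩
  have hK' : ∀ t ∈ Ioo (-ε) ε, ∀ s : ℝ,
      curv (velSnd (lift α) t s) (binormal o (lift α t) s) (velSnd (lift α) t s)
        (binormal o (lift α t) s) = K₀ ∧
      curv (binormal o (lift α t) s) (velSnd (lift α) t s) (normal (lift α t) s)
        (binormal o (lift α t) s) = 0 ∧
      curv (velSnd (lift α) t s) (binormal o (lift α t) s) (velSnd (lift α) t s)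
        (normal (lift α t) s) = 0 := by
    intro t ht s
    have hT := h.norm_velocity t s (hmem ht s)
    have hN := h.norm_normal t s (hmem ht s)
    have hB := h.norm_binormal t s (hmem ht s)
    have hTN := h.inner_tangent_normal t s (hmem ht s)
    have hBT := IsVortexFilament.inner_binormal_tangent o (lift α) t s
    have hBN := IsVortexFilament.inner_binormal_normal o (lift α) t s
    have hTB := (real_inner_comm _ _).trans hBT
    have hNT := (real_inner_comm _ _).trans hTN
    refine ⟨curv_eq_of_constant hK hT hB hTB, ?_, ?_⟩
    -- `(B,T,N,B) = -(T,B,N,B)`, which has the polarized form with repeated vector `B`.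
    · have := curv_polarized_of_constant hK hT hB hN hTB hTN hBN
      rw [curv, riemann_antisymm, inner_neg_left, neg_eq_zero]
      exact this
    -- Antisymmetry in both pairs gives `(T,B,T,N) = (B,T,N,T)`, the polarized form with repeated
    -- vector `T`.
    · have := curv_polarized_of_constant hK hB hT hN hBT hBN hTN
      rw [curv_antisymm_right, curv, riemann_antisymm, inner_neg_left, neg_neg]
      exact this
  have hψ : ∀ t ∈ Ioo (-ε) ε, ∀ s : ℝ, _ := fun t ht s =>
    hasDerivAt_hasimoto (κ := fun t => curvature (lift α t)) (τ := fun t => torsion o (lift α t))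
      isOpen_Ioo (fun p hp => h.contDiffAt_curvature hp) (fun p hp => h.contDiffAt_torsion hp) hcurv
      (fun t ht s => by
        rw [h.deriv_curvature (hmem ht s), (hK' t ht s).2.2, mul_zero, add_zero])
      (fun t ht s => by
        rw [(h.hasDerivAt_torsion (hmem ht s)).deriv, (hK' t ht s).2.1, mul_zero, sub_zero]
        -- Along the whole curve `(T,B,T,B)` is the constant `K₀`, so it does not affect the
        -- `s`-derivative.
        simp only [(hK' t ht _).1, deriv_add_const])
      ht s
  have hA : ContinuousOn (fun t => potential (curvature (lift α t)) (torsion o (lift α t)) 0)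
      (Ioo (-ε) ε) := fun t ht => by
    have h1 := contDiffAt_potential (κ := fun t => curvature (lift α t))
      (τ := fun t => torsion o (lift α t)) (h.contDiffAt_curvature (hmem ht 0))
      (h.contDiffAt_torsion (hmem ht 0)) (hcurv t ht 0)
    exact (ContinuousAt.comp (f := fun t : ℝ => (t, (0 : ℝ))) h1.continuousAt
      (by fun_prop)).continuousWithinAt
  refine ⟨hK', hA, fun t ht => ?_⟩
  have hψs : ContDiff ℝ ∞ (hasimoto (curvature (lift α t)) (torsion o (lift α t))) :=
    contDiff_hasimoto
      (contDiff_of_contDiffAt_slice (f := fun q : ℝ × ℝ => curvature (lift α q.1) q.2)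
        fun s => h.contDiffAt_curvature (hmem ht s))
      (contDiff_of_contDiffAt_slice (f := fun q : ℝ × ℝ => torsion o (lift α q.1) q.2)
        fun s => h.contDiffAt_torsion (hmem ht s))
  rw [show Ψ = _ from funext₂ hΨ]
  refine ⟨hψs, contDiff_const.mul hψs, fun s => ?_⟩
  have hΨt := hasDerivAt_gaugeRotate hA ht (hψ t ht s)
  refine ⟨(hψ t ht s).differentiableAt, ?_, hΨt.differentiableAt, ?_⟩
  · rw [(hψ t ht s).deriv, ← mul_assoc, neg_mul, Complex.I_mul_I, neg_neg, one_mul]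
  · rw [hΨt.deriv, deriv_deriv_gaugeRotate, norm_gaugeRotate]
    dsimp only [gaugeRotate]
    generalize Complex.exp _ = E
    generalize deriv (deriv (hasimoto _ _)) s = D
    generalize hasimoto _ _ s = z
    generalize potential _ _ 0 = P
    -- The derivative of the phase contributes `I * A * Ψ`, which cancels the term `-ψ * A` in the
    -- equation for `ψ`; only `I² = -1` remains to be used.
    linear_combination -(E * (D + 1 / 2 * (‖z‖ : ℂ) ^ 2 * z)) * Complex.I_sq
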